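/- Let $p$ be a prime number. For an amalgamated product $H_1 *_C H_2$ of groups along a common subgroup $C$, a normal form of $g$ is an expression $g = g_1 g_2\cdots g_k$ ($k\ge 1$) in which every $g_i$ lies in $H_1\setminus C$ or in $H_2\setminus C$ and consecutive $g_i$ lie in different factors; every $g\notin C$ has a normal form, and the length $k$ depends only on $g$ and is called the syllable length $\mathrm{Syl}(g)$; elements of $C$ have syllable length $0$. An element is called cyclically reduced if it lies in $C$ or if its syllable length is $1$ or even. Let $\Sigma_\rho$ be the closed oriented surface of genus $\rho \ge 2$, and let $\pi_1(\Sigma_\rho) = F_1 *_C F_2$ be a decomposition of its fundamental group as an amalgamated product in which, for some $n, m\ge 1$, $F_1 = F(x_1,\dots,x_n,y_1,\dots,y_n)$ is a free group of rank $2n$, $F_2 = F(x'_1,\dots,x'_m,y'_1,\dots,y'_m)$ is a free group of rank $2m$, and $C$ is the cyclic group generated by $$\gamma = [x_1,y_1]\cdots[x_n,y_n] = [x'_1,y'_1]\cdots[x'_m,y'_m].$$ Let $g\in\pi_1(\Sigma_\rho)$ be cyclically reduced of syllable length $2l\ge 2$, and let $h\in\pi_1(\Sigma_\rho)$ be an element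 that is not conjugate to $g$. Then there exist finite $p$-groups $P_1, P_2$, a cyclic group $\bar C$ embedded in both of them, and a homomorphism $\varphi : F_1 *_C F_2 \to P_1 *_{\bar C} P_2$ such that $\varphi(g)$ is cyclically reduced of syllable length $2l = \mathrm{Syl}(g)$ in $P_1 *_{\bar C} P_2$ and $\varphi(h)$ is not conjugate to $\varphi(g)$. -/

import Mathlib

/-- The point of the unit circle at position `s` along the boundary of the closed unit disc, when
the boundary is divided into `N` edges of equal length (edge `k` is `k ≤ s ≤ k + 1`). -/
noncomputable def polygonPoint (N : ℕ) (s : ℝ) : Metric.closedBall (0 : ℂ) 1 :=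
  ⟨(Circle.exp (2 * Real.pi * s / N) : ℂ), by
    rw [mem_closedBall_zero_iff, Circle.norm_coe]⟩

/-- The edge identifications of the `4ρ`-gon with boundary word
`a₁ b₁ a₁⁻¹ b₁⁻¹ ⋯ a_ρ b_ρ a_ρ⁻¹ b_ρ⁻¹`. -/
inductive SurfaceRel (ρ : ℕ) : Metric.closedBall (0 : ℂ) 1 → Metric.closedBall (0 : ℂ) 1 → Prop
  | edgeA (j : ℕ) (hj : j < ρ) (t : ℝ) (h0 : 0 ≤ t) (h1 : t ≤ 1) :
      SurfaceRel ρ (polygonPoint (4 * ρ) (4 * j + t)) (polygonPoint (4 * ρ) (4 * j + 3 - t))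
  | edgeB (j : ℕ) (hj : j < ρ) (t : ℝ) (h0 : 0 ≤ t) (h1 : t ≤ 1) :
      SurfaceRel ρ (polygonPoint (4 * ρ) (4 * j + 1 + t)) (polygonPoint (4 * ρ) (4 * j + 4 - t))

/-- The closed oriented surface of genus `ρ ≥ 1`: the closed disc, seen as a `4ρ`-gon, with its
edges identified in pairs, and the quotient topology. -/
def ClosedSurface (ρ : ℕ) : Type := Quot (SurfaceRel ρ)

instance (ρ : ℕ) : TopologicalSpace (ClosedSurface ρ) :=
  inferInstanceAs (TopologicalSpace (Quot (SurfaceRel ρ)))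

/-- The element `[x₁, y₁] ⋯ [x_k, y_k]` of the free group on `x₁, …, x_k, y₁, …, y_k`. -/
def commutatorProduct (k : ℕ) : FreeGroup (Fin k ⊕ Fin k) :=
  (List.ofFn fun i : Fin k =>
    FreeGroup.of (Sum.inl i) * FreeGroup.of (Sum.inr i) *
      (FreeGroup.of (Sum.inl i))⁻¹ * (FreeGroup.of (Sum.inr i))⁻¹).prod

/-- The two maps of the infinite cyclic group to the free groups of ranks `2 n₀` and `2 n₁`
that send the generator to the product of commutators `γ`. They are injective if `n₀, n₁ ≥ 1`. -/
def surfaceAmalgamMap (n : Fin 2 → ℕ) (i : Fin 2) :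
    Multiplicative ℤ →* FreeGroup (Fin (n i) ⊕ Fin (n i)) :=
  zpowersHom _ (commutatorProduct (n i))

/-- The amalgamated product `F₁ *_C F₂`, where `F₁` and `F₂` are free of ranks `2 n₀` and `2 n₁`
and `C` is generated by `γ = [x₁, y₁] ⋯ [x_{n₀}, y_{n₀}] = [x'₁, y'₁] ⋯ [x'_{n₁}, y'_{n₁}]`. -/
abbrev SurfaceAmalgam (n : Fin 2 → ℕ) : Type := Monoid.PushoutI (surfaceAmalgamMap n)

namespace Amalgam

open Monoid

variable {H : Fin 2 → Type*} [∀ i, Group (H i)] {C : Type*} [Group C] {φ : ∀ i, C →* H i}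

/-- `w` is a normal form of `g ∈ H₁ *_C H₂`: a nonempty word with product `g`, whose consecutive
letters come from different factors (this is part of `CoprodI.Word`) and none of whose letters
lies in `C`. -/
def IsNormalForm (g : PushoutI φ) (w : CoprodI.Word H) : Prop :=
  w.toList ≠ [] ∧ PushoutI.Reduced φ w ∧ PushoutI.ofCoprodI w.prod = g

/-- The syllable length of `g`: the length of its normal forms, and `0` for `g ∈ C` (which has no
normal form). By `IsNormalForm.length_eq` all normal forms of `g` have this length. -/
noncomputable def syllableLength (g : PushoutI φ) : ℕ :=
  sInf {k | ∃ w : CoprodI.Word H, IsNormalForm g w ∧ w.toList.length = k}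

/-- `g` is cyclically reduced: it lies in `C`, or has a normal form of length `1` or of even
length. -/
def IsCyclicallyReduced (g : PushoutI φ) : Prop :=
  g ∈ (PushoutI.base φ).range ∨
    ∃ w : CoprodI.Word H, IsNormalForm g w ∧ (w.toList.length = 1 ∨ Even w.toList.length)

theorem IsNormalForm.length_eq (hφ : ∀ i, Function.Injective (φ i)) {g : PushoutI φ}
    {w : CoprodI.Word H} (hw : IsNormalForm g w) : w.toList.length = syllableLength g := by
  have key : ∀ {w' : CoprodI.Word H}, IsNormalForm g w' → w'.toList.length = w.toList.length := by
    intro w' hw'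
    obtain ⟨d⟩ := PushoutI.NormalWord.transversal_nonempty φ hφ
    obtain ⟨v, hv, hvl⟩ := hw.2.1.exists_normalWord_prod_eq d
    obtain ⟨v', hv', hvl'⟩ := hw'.2.1.exists_normalWord_prod_eq d
    have : v = v' := PushoutI.NormalWord.prod_injective (by rw [hv, hv', hw.2.2, hw'.2.2])
    subst this
    simpa using congrArg List.length (hvl'.symm.trans hvl)
  obtain ⟨w', hw', h⟩ := Nat.sInf_mem
    (⟨_, w, hw, rfl⟩ : {k | ∃ w : CoprodI.Word H, IsNormalForm g w ∧ w.toList.length = k}.Nonempty)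
  exact (key hw').symm.trans h

end Amalgam

/-!
Conjugate elements of an amalgamated product that are given by cyclically reduced words have, up to
a rotation of the words, letters `x`, `y` that are linked by equations `γ ^ a * x = y * γ ^ b`, in
which the exponents match up around the cycle. To transport non-conjugacy to a quotient amalgam it
is therefore enough to find finite `p`-quotients of the factors, with the same order of `γ`, in
which every solution `(a, b)` of one of the finitely many letter equations is `p`-adically close to
a solution in the factors themselves; in the latter, a solution is unique.

Such quotients come from the Fox calculus: for a normal subgroup `N` of `p`-power index, the
elements of `N` on which a given Fox derivation vanishes modulo `p ^ k` form a smaller normal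
subgroup of `p`-power index. If `γ` is a product of commutators, there are Fox derivations whose
value at `γ` is `1 - v`. The value at `γ ^ p ^ r`, the first power of `γ` in `N`, then has
coefficient `1` at `1` and coefficient `0` at `h⁻¹`, so that the classes modulo `p ^ k` of the
exponents `a`, `b` can be read off from the image of `γ ^ (p ^ r * a) * h * γ ^ (p ^ r * b) * h⁻¹`.
-/

/-! ### Conjugacy in amalgamated products -/

namespace Amalgam

open Monoid

variable {ι : Type*} {G : ι → Type*} [∀ i, Group (G i)] {C : Type*} [Group C]

/-- The product in the amalgam of a word, that is, of a list of elements of the factors. -/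
def listProd (φ : ∀ i, C →* G i) (L : List (Σ i, G i)) : PushoutI φ :=
  (L.map fun x => PushoutI.of x.1 x.2).prod

/-- A word is reduced if consecutive letters come from different factors and no letter lies in the
amalgamated subgroup. The empty word is reduced. -/
structure IsReduced (φ : ∀ i, C →* G i) (L : List (Σ i, G i)) : Prop where
  isChain : (L.map Sigma.fst).IsChain (· ≠ ·)
  notMem_range : ∀ x ∈ L, x.2 ∉ (φ x.1).range

/-- The formal inverse of a word. -/
def listInv (L : List (Σ i, G i)) : List (Σ i, G i) :=
  (L.map fun x => ⟨x.1, x.2⁻¹⟩).reverse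

variable {φ : ∀ i, C →* G i}

section Words

@[simp] theorem listProd_nil : listProd φ [] = 1 := rfl

@[simp] theorem listProd_cons (x : Σ i, G i) (L : List (Σ i, G i)) :
    listProd φ (x :: L) = PushoutI.of x.1 x.2 * listProd φ L := by
  simp [listProd]

@[simp] theorem listProd_append (L M : List (Σ i, G i)) :
    listProd φ (L ++ M) = listProd φ L * listProd φ M := by
  simp [listProd]

@[simp] theorem listProd_listInv (L : List (Σ i, G i)) :
    listProd φ (listInv L) = (listProd φ L)⁻¹ := by
  simp [listProd, listInv, List.prod_inv_reverse, Function.comp_def]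

theorem ofCoprodI_prod_eq_listProd (w : CoprodI.Word G) :
    (PushoutI.ofCoprodI w.prod : PushoutI φ) = listProd φ w.toList := by
  simp [CoprodI.Word.prod, listProd, map_list_prod, Function.comp_def]

theorem base_mul_listProd_cons (c : C) (i : ι) (x : G i) (L : List (Σ i, G i)) :
    PushoutI.base φ c * listProd φ (⟨i, x⟩ :: L) = listProd φ (⟨i, φ i c * x⟩ :: L) := by
  simp [PushoutI.of_apply_eq_base, mul_assoc]

@[simp] theorem map_fst_listInv (L : List (Σ i, G i)) :
    (listInv L).map Sigma.fst = (L.map Sigma.fst).reverse := by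
  simp [listInv, Function.comp_def]

theorem mul_notMem_range_left {i : ι} (c : C) {x : G i} (hx : x ∉ (φ i).range) :
    φ i c * x ∉ (φ i).range :=
  mt (Subgroup.mul_mem_cancel_left _ (MonoidHom.mem_range.2 ⟨c, rfl⟩)).1 hx

theorem mul_notMem_range_right {i : ι} (c : C) {x : G i} (hx : x ∉ (φ i).range) :
    x * φ i c ∉ (φ i).range :=
  mt (Subgroup.mul_mem_cancel_right _ (MonoidHom.mem_range.2 ⟨c, rfl⟩)).1 hx

theorem isReduced_nil : IsReduced φ ([] : List (Σ i, G i)) :=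
  ⟨List.isChain_nil, by simp⟩

theorem isReduced_singleton {x : Σ i, G i} : IsReduced φ [x] ↔ x.2 ∉ (φ x.1).range :=
  ⟨fun h => h.notMem_range x List.mem_cons_self,
    fun h => ⟨List.isChain_singleton _, by simpa using h⟩⟩

theorem isReduced_append {L M : List (Σ i, G i)} :
    IsReduced φ (L ++ M) ↔ IsReduced φ L ∧ IsReduced φ M ∧
      ∀ i ∈ (L.map Sigma.fst).getLast?, ∀ j ∈ (M.map Sigma.fst).head?, i ≠ j := by
  constructor
  · rintro ⟨hchain, hrange⟩
    rw [List.map_append, List.isChain_append] at hchain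
    rw [List.forall_mem_append] at hrange
    exact ⟨⟨hchain.1, hrange.1⟩, ⟨hchain.2.1, hrange.2⟩, hchain.2.2⟩
  · rintro ⟨⟨hL, hL'⟩, ⟨hM, hM'⟩, h⟩
    exact ⟨by rw [List.map_append, List.isChain_append]; exact ⟨hL, hM, h⟩,
      List.forall_mem_append.2 ⟨hL', hM'⟩⟩

theorem isReduced_cons {x : Σ i, G i} {L : List (Σ i, G i)} :
    IsReduced φ (x :: L) ↔ x.2 ∉ (φ x.1).range ∧ IsReduced φ L ∧
      ∀ j ∈ (L.map Sigma.fst).head?, x.1 ≠ j := by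
  rw [← List.singleton_append, isReduced_append, isReduced_singleton]
  simp

theorem isReduced_concat {x : Σ i, G i} {L : List (Σ i, G i)} :
    IsReduced φ (L ++ [x]) ↔ IsReduced φ L ∧ x.2 ∉ (φ x.1).range ∧
      ∀ i ∈ (L.map Sigma.fst).getLast?, i ≠ x.1 := by
  rw [isReduced_append, isReduced_singleton]
  simp

theorem IsReduced.listInv {L : List (Σ i, G i)} (h : IsReduced φ L) :
    IsReduced φ (listInv L) := by
  refine ⟨?_, fun x hx => ?_⟩
  · rw [map_fst_listInv, List.isChain_reverse]
    simpa only [ne_comm] using h.isChain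
  · obtain ⟨y, hy, rfl⟩ : ∃ y ∈ L, ⟨y.1, y.2⁻¹⟩ = x := by simpa [Amalgam.listInv] using hx
    simpa using h.notMem_range y hy

/-- A reduced word as a word of the free product of the factors, to which the normal form theory
of `PushoutI` applies. -/
def IsReduced.word {L : List (Σ i, G i)} (h : IsReduced φ L) : CoprodI.Word G where
  toList := L
  ne_one := fun x hx h1 => h.notMem_range x hx (h1 ▸ one_mem _)
  chain_ne := (List.isChain_map _).1 h.isChain

theorem IsReduced.eq_nil (hφ : ∀ i, Function.Injective (φ i)) {L : List (Σ i, G i)}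
    (h : IsReduced φ L) (hL : listProd φ L ∈ (PushoutI.base φ).range) : L = [] := by
  have hw : (PushoutI.ofCoprodI h.word.prod : PushoutI φ) ∈ (PushoutI.base φ).range := by
    rwa [ofCoprodI_prod_eq_listProd]
  exact congrArg CoprodI.Word.toList
    (PushoutI.Reduced.eq_empty_of_mem_range hφ (w := h.word) h.notMem_range hw)

theorem exists_isReduced (hφ : ∀ i, Function.Injective (φ i)) (g : PushoutI φ) :
    ∃ c L, IsReduced φ L ∧ g = PushoutI.base φ c * listProd φ L := by
  classical
  obtain ⟨d⟩ := PushoutI.NormalWord.transversal_nonempty φ hφ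
  obtain ⟨w, rfl⟩ : ∃ w : PushoutI.NormalWord d, w.prod = g :=
    ⟨PushoutI.NormalWord.equiv g, PushoutI.NormalWord.equiv.symm_apply_apply g⟩
  refine ⟨w.head, w.toList, ⟨(List.isChain_map _).2 w.chain_ne, ?_⟩, ?_⟩
  · rintro ⟨i, x⟩ hx hr
    have := (d.compl i).1 (a₁ := (⟨x, hr⟩, ⟨1, d.one_mem i⟩))
      (a₂ := (⟨1, one_mem _⟩, ⟨x, w.normalized i x hx⟩)) (by simp)
    exact w.ne_one _ hx (by simpa using (congrArg (fun q => (q.2 : G i)) this).symm)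
  · rw [PushoutI.NormalWord.prod, ofCoprodI_prod_eq_listProd]

theorem IsReduced.map_fst_eq (hφ : ∀ i, Function.Injective (φ i)) {L M : List (Σ i, G i)}
    (hL : IsReduced φ L) (hM : IsReduced φ M) (h : listProd φ L = listProd φ M) :
    L.map Sigma.fst = M.map Sigma.fst := by
  classical
  obtain ⟨d⟩ := PushoutI.NormalWord.transversal_nonempty φ hφ
  obtain ⟨v, hv, hvL⟩ := PushoutI.Reduced.exists_normalWord_prod_eq d (w := hL.word) hL.notMem_range
  obtain ⟨w, hw, hwM⟩ := PushoutI.Reduced.exists_normalWord_prod_eq d (w := hM.word) hM.notMem_range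
  obtain rfl : v = w := PushoutI.NormalWord.prod_injective <| by
    rw [hv, hw, ofCoprodI_prod_eq_listProd, ofCoprodI_prod_eq_listProd]
    exact h
  exact hvL.symm.trans hwM

theorem IsReduced.exists_mul_base {L : List (Σ i, G i)} (hL : IsReduced φ L) (hne : L ≠ [])
    (c : C) : ∃ M, IsReduced φ M ∧ M.map Sigma.fst = L.map Sigma.fst ∧
      listProd φ M = listProd φ L * PushoutI.base φ c := by
  obtain ⟨L, ⟨i, x⟩, rfl⟩ := (List.eq_nil_or_concat' L).resolve_left hne
  rw [isReduced_concat] at hL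
  exact ⟨L ++ [⟨i, x * φ i c⟩],
    isReduced_concat.2 ⟨hL.1, mul_notMem_range_right c hL.2.1, hL.2.2⟩, by simp,
    by simp [PushoutI.of_apply_eq_base, mul_assoc]⟩

theorem IsReduced.map_fst_eq_of_base_mul_eq (hφ : ∀ i, Function.Injective (φ i)) {c c' : C}
    {L M : List (Σ i, G i)} (hL : IsReduced φ L) (hM : IsReduced φ M)
    (h : PushoutI.base φ c * listProd φ L = listProd φ M * PushoutI.base φ c') :
    L.map Sigma.fst = M.map Sigma.fst := by
  rcases eq_or_ne M [] with rfl | hne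
  · rw [hL.eq_nil hφ ⟨c⁻¹ * c', by simp [eq_inv_mul_iff_mul_eq.2 h]⟩]
  rcases L with _ | ⟨⟨i, x⟩, L⟩
  · rw [hM.eq_nil hφ ⟨c * c'⁻¹, by simp [eq_mul_inv_iff_mul_eq.2 h.symm]⟩]
  obtain ⟨M', hM', hfst, hprod⟩ := hM.exists_mul_base hne c'
  rw [isReduced_cons] at hL
  have hcL : IsReduced φ (⟨i, φ i c * x⟩ :: L) :=
    isReduced_cons.2 ⟨mul_notMem_range_left c hL.1, hL.2⟩
  rw [← hfst, ← hcL.map_fst_eq hφ hM' (by rw [hprod, ← h, base_mul_listProd_cons])]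
  simp

end Words

section Linked

/-- `Linked φ c L M d` says that the words `L` and `M` are letterwise in the same double cosets of
the amalgamated subgroup, by means of a sequence of elements of that subgroup that begins with `c`
and ends with `d`. -/
inductive Linked (φ : ∀ i, C →* G i) : C → List (Σ i, G i) → List (Σ i, G i) → C → Prop
  | nil (c : C) : Linked φ c [] [] c
  | cons {c d e : C} {i : ι} {x y : G i} {L M : List (Σ i, G i)} :
      φ i c * x = y * φ i d → Linked φ d L M e → Linked φ c (⟨i, x⟩ :: L) (⟨i, y⟩ :: M) e

theorem Linked.base_mul_eq {c d : C} {L M : List (Σ i, G i)} (h : Linked φ c L M d) :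
    PushoutI.base φ c * listProd φ L = listProd φ M * PushoutI.base φ d := by
  induction h with
  | nil => simp
  | @cons c d e i x y L M hxy _ ih =>
    have hletter : PushoutI.base φ c * PushoutI.of i x = PushoutI.of i y * PushoutI.base φ d := by
      simpa [PushoutI.of_apply_eq_base] using congrArg (PushoutI.of (φ := φ) i) hxy
    rw [listProd_cons, listProd_cons, ← mul_assoc, hletter, mul_assoc, ih, mul_assoc]

theorem linked_of_base_mul_eq (hφ : ∀ i, Function.Injective (φ i)) {c d : C}
    {L M : List (Σ i, G i)} (hL : IsReduced φ L) (hM : IsReduced φ M)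
    (h : PushoutI.base φ c * listProd φ L = listProd φ M * PushoutI.base φ d) :
    Linked φ c L M d := by
  have hfst := hL.map_fst_eq_of_base_mul_eq hφ hM h
  induction L generalizing c M with
  | nil =>
    obtain rfl : M = [] := by simpa using hfst.symm
    obtain rfl : c = d := PushoutI.base_injective hφ (by simpa using h)
    exact .nil c
  | cons x L ih =>
    obtain ⟨i, x⟩ := x
    rcases M with _ | ⟨⟨j, y⟩, M⟩
    · simp at hfst
    obtain ⟨rfl, htailfst⟩ : i = j ∧ L.map Sigma.fst = M.map Sigma.fst := by simpa using hfst
    rw [isReduced_cons] at hL hM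
    have htail : PushoutI.of i (y⁻¹ * (φ i c * x)) * listProd φ L
        = listProd φ M * PushoutI.base φ d := by
      simpa [PushoutI.of_apply_eq_base, mul_assoc, inv_mul_eq_iff_eq_mul] using h
    by_cases hmem : y⁻¹ * (φ i c * x) ∈ (φ i).range
    · obtain ⟨c₁, hc₁⟩ := hmem
      refine .cons (d := c₁) (by rw [hc₁]; group) (ih hL.2.1 hM.2.1 ?_ htailfst)
      rw [← htail, ← hc₁, PushoutI.of_apply_eq_base]
    · have hred : IsReduced φ (⟨i, y⁻¹ * (φ i c * x)⟩ :: L) := isReduced_cons.2 ⟨hmem, hL.2⟩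
      have hlen := congrArg List.length <|
        hred.map_fst_eq_of_base_mul_eq (c := 1) hφ hM.2.1 (by simpa using htail)
      simp [← htailfst] at hlen

end Linked

section Conjugacy

/-- A reduced word is cyclic if its first and last letters come from different factors, so that
all its rotations are reduced as well. The empty word and words of length one are not cyclic. -/
structure IsCyclicList (φ : ∀ i, C →* G i) (L : List (Σ i, G i)) : Prop where
  isReduced : IsReduced φ L
  head?_ne_getLast? : (L.map Sigma.fst).head? ≠ (L.map Sigma.fst).getLast?

theorem isCyclicList_cons {x : Σ i, G i} {L : List (Σ i, G i)} :
    IsCyclicList φ (x :: L) ↔ IsReduced φ (x :: (L ++ [x])) := by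
  rw [← List.cons_append, isReduced_concat]
  refine ⟨fun h => ⟨h.1, h.1.notMem_range x List.mem_cons_self, ?_⟩, fun h => ⟨h.1, ?_⟩⟩
  · rintro i hi rfl
    exact h.2 hi.symm
  · intro hlast
    exact h.2.2 x.1 (by rw [← hlast]; rfl) rfl

theorem isCyclicList_concat {x : Σ i, G i} {L : List (Σ i, G i)} :
    IsCyclicList φ (L ++ [x]) ↔ IsReduced φ (x :: (L ++ [x])) := by
  rw [isReduced_cons]
  refine ⟨fun h => ⟨h.1.notMem_range x (by simp), h.1, ?_⟩, fun h => ⟨h.2.1, ?_⟩⟩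
  · rintro i hi rfl
    exact h.2 (hi.trans (by simp))
  · intro hhead
    exact h.2.2 x.1 (hhead.trans (by simp)) rfl

theorem IsCyclicList.of_isRotated {L M : List (Σ i, G i)} (hL : IsCyclicList φ L) (h : L ~r M) :
    IsCyclicList φ M := by
  obtain ⟨n, rfl⟩ := h
  induction n generalizing L with
  | zero => simpa using hL
  | succ n ih =>
    rcases L with _ | ⟨x, L⟩
    · simpa using hL
    · rw [List.rotate_cons_succ]
      exact ih (isCyclicList_concat.2 (isCyclicList_cons.1 hL))

theorem isConj_listProd_of_isRotated {L M : List (Σ i, G i)} (h : L ~r M) :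
    IsConj (listProd φ L) (listProd φ M) := by
  obtain ⟨n, rfl⟩ := h
  induction n generalizing L with
  | zero => simpa only [List.rotate_zero] using IsConj.refl _
  | succ n ih =>
    rcases L with _ | ⟨x, L⟩
    · simpa only [List.rotate_nil] using IsConj.refl _
    · rw [List.rotate_cons_succ]
      refine IsConj.trans (isConj_iff.2 ⟨(PushoutI.of x.1 x.2)⁻¹, ?_⟩) ih
      simp

theorem IsReduced.conj {i : ι} {x : G i} {T M : List (Σ i, G i)} (hT : IsReduced φ (⟨i, x⟩ :: T))
    (hM : IsReduced φ M) (hhead : (M.map Sigma.fst).head? = some i)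
    (hlast : (M.map Sigma.fst).getLast? = some i) :
    IsReduced φ (Amalgam.listInv T ++ (M ++ T)) := by
  have hne : ∀ j ∈ (T.map Sigma.fst).head?, i ≠ j := (isReduced_cons.1 hT).2.2
  have hred := (isReduced_cons.1 hT).2.1
  refine isReduced_append.2 ⟨hred.listInv, isReduced_append.2 ⟨hM, hred, ?_⟩, ?_⟩
  · rintro k hk j hj
    obtain rfl : i = k := Option.some.inj (hlast.symm.trans hk)
    exact hne j hj
  · intro k hk j hj
    rw [map_fst_listInv, List.getLast?_reverse] at hk
    rw [List.map_append, List.head?_append, hhead] at hj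
    obtain rfl : i = j := by simpa using hj
    exact (hne k hk).symm

theorem head?_eq_getLast?_listInv_append (T : List (Σ i, G i)) {M : List (Σ i, G i)}
    (hM : (M.map Sigma.fst).head? = (M.map Sigma.fst).getLast?) :
    ((listInv T ++ (M ++ T)).map Sigma.fst).head? =
      ((listInv T ++ (M ++ T)).map Sigma.fst).getLast? := by
  simp only [List.map_append, map_fst_listInv, List.head?_append, List.getLast?_append,
    List.head?_reverse, List.getLast?_reverse, hM]
  cases (T.map Sigma.fst).getLast? <;> simp

theorem IsReduced.cons_of_fst {i : ι} {x y : G i} {L : List (Σ i, G i)}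
    (h : IsReduced φ (⟨i, x⟩ :: L)) (hy : y ∉ (φ i).range) : IsReduced φ (⟨i, y⟩ :: L) :=
  isReduced_cons.2 ⟨hy, (isReduced_cons.1 h).2⟩

theorem IsReduced.concat_of_fst {i : ι} {x y : G i} {L : List (Σ i, G i)}
    (h : IsReduced φ (L ++ [⟨i, x⟩])) (hy : y ∉ (φ i).range) : IsReduced φ (L ++ [⟨i, y⟩]) :=
  isReduced_concat.2 ⟨(isReduced_concat.1 h).1, hy, (isReduced_concat.1 h).2.2⟩

theorem exists_isReduced_conj_of {i : ι} {x : G i} (hx : x ∉ (φ i).range) {L : List (Σ i, G i)}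
    (hL : IsCyclicList φ L) (hhead : ∀ y M, L = ⟨i, y⟩ :: M → x⁻¹ * y ∉ (φ i).range)
    (hlast : ∀ z M, L = M ++ [⟨i, z⟩] → z * x ∉ (φ i).range) :
    ∃ M, IsReduced φ M ∧ (M.map Sigma.fst).head? = some i ∧ (M.map Sigma.fst).getLast? = some i ∧
      listProd φ M = (PushoutI.of i x)⁻¹ * listProd φ L * PushoutI.of i x := by
  have hx' : x⁻¹ ∉ (φ i).range := by simpa using hx
  by_cases hi : ∃ y M, L = ⟨i, y⟩ :: M
  · obtain ⟨y, M, rfl⟩ := hi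
    refine ⟨⟨i, x⁻¹ * y⟩ :: (M ++ [⟨i, x⟩]), ?_, by simp, by simp [List.getLast?_cons],
      by simp [mul_assoc]⟩
    exact (IsReduced.concat_of_fst (L := ⟨i, y⟩ :: M) (isCyclicList_cons.1 hL) hx).cons_of_fst
      (hhead y M rfl)
  by_cases hj : ∃ z M, L = M ++ [⟨i, z⟩]
  · obtain ⟨z, M, rfl⟩ := hj
    refine ⟨⟨i, x⁻¹⟩ :: (M ++ [⟨i, z * x⟩]), ?_, by simp, by simp [List.getLast?_cons],
      by simp [mul_assoc]⟩
    exact IsReduced.concat_of_fst (L := ⟨i, x⁻¹⟩ :: M)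
      ((isCyclicList_concat.1 hL).cons_of_fst hx') (hlast z M rfl)
  · refine ⟨⟨i, x⁻¹⟩ :: (L ++ [⟨i, x⟩]), ?_, by simp, by simp [List.getLast?_cons],
      by simp [mul_assoc]⟩
    rw [← List.cons_append, isReduced_concat, isReduced_cons]
    refine ⟨⟨hx', hL.1, ?_⟩, hx, ?_⟩
    · rintro k hk rfl
      obtain ⟨⟨i, y⟩, M, rfl⟩ := List.exists_cons_of_ne_nil (l := L) (by rintro rfl; simp at hk)
      simp only [List.map_cons, List.head?_cons, Option.mem_some_iff] at hk
      subst hk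
      exact hi ⟨y, M, rfl⟩
    · rintro k hk rfl
      obtain ⟨M, ⟨i, z⟩, rfl⟩ := (List.eq_nil_or_concat' L).resolve_left
        (by rintro rfl; exact hL.2 rfl)
      obtain rfl : i = k := by simpa [List.getLast?_cons] using hk
      exact hj ⟨z, M, rfl⟩

theorem exists_isRotated_or_isReduced_of_conj {L T : List (Σ i, G i)} (hL : IsCyclicList φ L)
    (hT : IsReduced φ T) {c : C} {g : PushoutI φ}
    (hg : g = (PushoutI.base φ c * listProd φ T)⁻¹ * listProd φ L *
      (PushoutI.base φ c * listProd φ T)) :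
    (∃ M d, L ~r M ∧ g = PushoutI.base φ d * listProd φ M * (PushoutI.base φ d)⁻¹) ∨
    ∃ M, IsReduced φ M ∧ (M.map Sigma.fst).head? = (M.map Sigma.fst).getLast? ∧
      g = listProd φ M := by
  induction T generalizing c L with
  | nil => exact .inl ⟨L, c⁻¹, .refl L, by simp [hg]⟩
  | cons x T ih =>
    obtain ⟨i, x⟩ := x
    rw [base_mul_listProd_cons] at hg
    replace hT := hT.cons_of_fst (mul_notMem_range_left c (isReduced_cons.1 hT).1)
    generalize φ i c * x = x at hg hT
    have hTred := (isReduced_cons.1 hT).2.1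
    by_cases hhead : ∀ y M, L = ⟨i, y⟩ :: M → x⁻¹ * y ∉ (φ i).range
    · by_cases hlast : ∀ z M, L = M ++ [⟨i, z⟩] → z * x ∉ (φ i).range
      · obtain ⟨M, hM, hMhead, hMlast, hprod⟩ :=
          exists_isReduced_conj_of (isReduced_cons.1 hT).1 hL hhead hlast
        exact .inr ⟨listInv T ++ (M ++ T), hT.conj hM hMhead hMlast,
          head?_eq_getLast?_listInv_append T (hMhead.trans hMlast.symm),
          by simp [hg, hprod, mul_assoc]⟩
      · push Not at hlast
        obtain ⟨z, M, rfl, b, hb⟩ := hlast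
        have hrot : M ++ [⟨i, z⟩] ~r ⟨i, z⟩ :: M := List.isRotated_append
        have hx : (PushoutI.of i x : PushoutI φ) = (PushoutI.of i z)⁻¹ * PushoutI.base φ b := by
          rw [← PushoutI.of_apply_eq_base φ i, hb]; simp
        rcases ih (c := b) (hL.of_isRotated hrot) hTred (by simp [hg, hx, mul_assoc])
          with ⟨N, d, hN, h⟩ | h
        exacts [.inl ⟨N, d, hrot.trans hN, h⟩, .inr h]
    · push Not at hhead
      obtain ⟨y, M, rfl, b, hb⟩ := hhead
      have hrot : ⟨i, y⟩ :: M ~r M ++ [⟨i, y⟩] := List.isRotated_append (l := [(⟨i, y⟩ : Σ i, G i)])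
      have hx : (PushoutI.of i x : PushoutI φ) = PushoutI.of i y * (PushoutI.base φ b)⁻¹ := by
        rw [← PushoutI.of_apply_eq_base φ i, hb]; simp
      rcases ih (c := b⁻¹) (hL.of_isRotated hrot) hTred (by simp [hg, hx, mul_assoc])
        with ⟨N, d, hN, h⟩ | h
      exacts [.inl ⟨N, d, hrot.trans hN, h⟩, .inr h]

theorem exists_isReduced_of_conj_of {T : List (Σ i, G i)} (hT : IsReduced φ T) {c : C} {i : ι}
    {x : G i} {g : PushoutI φ} (hg : g = (PushoutI.base φ c * listProd φ T)⁻¹ * PushoutI.of i x *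
      (PushoutI.base φ c * listProd φ T)) :
    ∃ d M, IsReduced φ M ∧ (M.map Sigma.fst).head? = (M.map Sigma.fst).getLast? ∧
      g = PushoutI.base φ d * listProd φ M := by
  induction T generalizing c i x with
  | nil =>
    obtain ⟨y, hy⟩ : ∃ y, g = PushoutI.of i y :=
      ⟨(φ i c)⁻¹ * x * φ i c, by simp [hg, PushoutI.of_apply_eq_base]⟩
    by_cases hr : y ∈ (φ i).range
    · obtain ⟨d, rfl⟩ := hr
      exact ⟨d, [], isReduced_nil, rfl, by simp [hy, PushoutI.of_apply_eq_base]⟩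
    · exact ⟨1, [⟨i, y⟩], isReduced_singleton.2 hr, rfl, by simp [hy]⟩
  | cons y T ih =>
    obtain ⟨j, y⟩ := y
    rw [base_mul_listProd_cons] at hg
    replace hT := hT.cons_of_fst (mul_notMem_range_left c (isReduced_cons.1 hT).1)
    generalize φ j c * y = y at hg hT
    have hy : y ∉ (φ j).range := (isReduced_cons.1 hT).1
    have hfactor (z : G j) (hz : (PushoutI.of i x : PushoutI φ) = PushoutI.of j z) :
        ∃ d M, IsReduced φ M ∧ (M.map Sigma.fst).head? = (M.map Sigma.fst).getLast? ∧
          g = PushoutI.base φ d * listProd φ M :=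
      ih (isReduced_cons.1 hT).2.1 (c := 1) (i := j) (x := y⁻¹ * z * y)
        (by simp [hg, hz, mul_assoc])
    by_cases hij : i = j
    · subst hij
      exact hfactor x rfl
    by_cases hx : x ∈ (φ i).range
    · obtain ⟨d, rfl⟩ := hx
      exact hfactor (φ j d) (by simp [PushoutI.of_apply_eq_base])
    · have hM : IsReduced φ [⟨j, y⁻¹⟩, ⟨i, x⟩, ⟨j, y⟩] := by
        simp only [isReduced_cons, isReduced_nil]
        simp_all [eq_comm]
      exact ⟨1, listInv T ++ ([⟨j, y⁻¹⟩, ⟨i, x⟩, ⟨j, y⟩] ++ T), hT.conj hM rfl rfl,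
        head?_eq_getLast?_listInv_append T rfl, by simp [hg, mul_assoc]⟩

theorem IsCyclicList.not_isConj_of (hφ : ∀ i, Function.Injective (φ i)) {L : List (Σ i, G i)}
    (hL : IsCyclicList φ L) (i : ι) (x : G i) : ¬ IsConj (PushoutI.of i x) (listProd φ L) := by
  intro hconj
  obtain ⟨k, hk⟩ := isConj_iff.1 hconj
  obtain ⟨c, T, hT, hkT⟩ := exists_isReduced hφ k⁻¹
  obtain ⟨d, M, hM, hsymm, hprod⟩ :=
    exists_isReduced_of_conj_of hT (c := c) (i := i) (x := x) (g := listProd φ L)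
      (by rw [← hkT, ← hk, inv_inv])
  refine hL.2 ?_
  rwa [← hM.map_fst_eq_of_base_mul_eq (c := d) (c' := 1) hφ hL.1 (by simp [hprod])]

theorem IsCyclicList.exists_linked_of_isConj (hφ : ∀ i, Function.Injective (φ i))
    {L L' : List (Σ i, G i)} (hL : IsCyclicList φ L) (hL' : IsCyclicList φ L')
    (h : IsConj (listProd φ L) (listProd φ L')) : ∃ M c, L ~r M ∧ Linked φ c M L' c := by
  obtain ⟨k, hk⟩ := isConj_iff.1 h
  obtain ⟨c, T, hT, hkT⟩ := exists_isReduced hφ k⁻¹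
  rcases exists_isRotated_or_isReduced_of_conj hL hT (c := c) (g := listProd φ L')
    (by rw [← hkT, ← hk, inv_inv]) with ⟨M, d, hM, hprod⟩ | ⟨M, hM, hsymm, hprod⟩
  · exact ⟨M, d, hM, linked_of_base_mul_eq hφ (hL.of_isRotated hM).1 hL'.1 (by simp [hprod])⟩
  · refine absurd hsymm ?_
    rw [← hL'.1.map_fst_eq hφ hM hprod]
    exact hL'.2

theorem exists_isConj_of_or_isCyclicList [Nonempty ι] (hφ : ∀ i, Function.Injective (φ i))
    (g : PushoutI φ) : (∃ i x, IsConj (PushoutI.of i x) g) ∨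
      ∃ L, IsCyclicList φ L ∧ IsConj (listProd φ L) g := by
  obtain ⟨c, L, hL, rfl⟩ := exists_isReduced hφ g
  induction hn : L.length using Nat.strong_induction_on generalizing c L with
  | _ n ih =>
    subst hn
    rcases L with _ | ⟨⟨i, x⟩, L⟩
    · inhabit ι
      exact .inl ⟨default, φ _ c, by rw [PushoutI.of_apply_eq_base, listProd_nil, mul_one]⟩
    rw [base_mul_listProd_cons]
    replace hL := hL.cons_of_fst (mul_notMem_range_left c (isReduced_cons.1 hL).1)
    generalize φ i c * x = x at hL
    rcases List.eq_nil_or_concat' L with rfl | ⟨L, ⟨j, z⟩, rfl⟩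
    · exact .inl ⟨i, x, by rw [listProd_cons, listProd_nil, mul_one]⟩
    by_cases hij : i = j
    · subst hij
      have hconj : IsConj (PushoutI.of i (z * x) * listProd φ L)
          (listProd φ (⟨i, x⟩ :: (L ++ [⟨i, z⟩]))) :=
        isConj_iff.2 ⟨(PushoutI.of i z)⁻¹, by simp [mul_assoc]⟩
      obtain ⟨d, M, hM, hlen, hprod⟩ : ∃ d M, IsReduced φ M ∧ M.length ≤ L.length + 1 ∧
          PushoutI.of i (z * x) * listProd φ L = PushoutI.base φ d * listProd φ M := by
        have hxL := (isReduced_concat (L := ⟨i, x⟩ :: L)).1 hL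
        by_cases hr : z * x ∈ (φ i).range
        · obtain ⟨d, hd⟩ := hr
          exact ⟨d, L, (isReduced_cons.1 hxL.1).2.1, by lia,
            by rw [← hd, PushoutI.of_apply_eq_base]⟩
        · exact ⟨1, ⟨i, z * x⟩ :: L, hxL.1.cons_of_fst hr, by simp, by simp⟩
      rw [hprod] at hconj
      rcases ih M.length (by simp; lia) d M hM rfl with ⟨k, y, h⟩ | ⟨W, hW, h⟩
      exacts [.inl ⟨k, y, h.trans hconj⟩, .inr ⟨W, hW, h.trans hconj⟩]
    · exact .inr ⟨_, ⟨hL, by simpa [List.getLast?_cons] using hij⟩, .refl _⟩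

end Conjugacy

end Amalgam

/-! ### Separation of the double cosets of a boundary element -/

section PNormal

open Filter

/-- `N` is open and normal in the pro-`p` topology: a normal subgroup whose index is a power
of `p`. -/
structure IsPNormal (p : ℕ) {F : Type*} [Group F] (N : Subgroup F) : Prop where
  normal : N.Normal
  exists_index_eq : ∃ j, N.index = p ^ j

/-- The normal subgroups of `p`-power index, ordered by inclusion: the filter `atBot` on this type
expresses that a property holds for all sufficiently small ones. -/
abbrev PNormal (p : ℕ) (F : Type*) [Group F] : Type _ := {N : Subgroup F // IsPNormal p N}

/-- The group is residually a finite `p`-group. -/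
def IsResiduallyP (p : ℕ) (F : Type*) [Group F] : Prop :=
  ∀ g : F, g ≠ 1 → ∃ N : Subgroup F, IsPNormal p N ∧ g ∉ N

variable {p : ℕ} {F : Type*} [Group F]

instance (N : PNormal p F) : N.1.Normal := N.2.normal

instance : Nonempty (PNormal p F) := ⟨⟨⊤, inferInstance, 0, by simp⟩⟩

theorem isPGroup_quotient (N : PNormal p F) : IsPGroup p (F ⧸ N.1) :=
  let ⟨_, hj⟩ := N.2.exists_index_eq
  IsPGroup.of_card hj

variable [hp : Fact p.Prime]

theorem IsPNormal.of_relIndex_dvd {M N : Subgroup F} (hN : IsPNormal p N) (hM : M.Normal)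
    (hMN : M ≤ N) {j : ℕ} (h : M.relIndex N ∣ p ^ j) : IsPNormal p M := by
  obtain ⟨k, -, hk⟩ := (Nat.dvd_prime_pow hp.out).1 h
  obtain ⟨l, hl⟩ := hN.exists_index_eq
  exact ⟨hM, k + l, by rw [← Subgroup.relIndex_mul_index hMN, hk, hl, pow_add]⟩

theorem IsPNormal.inf {M N : Subgroup F} (hM : IsPNormal p M) (hN : IsPNormal p N) :
    IsPNormal p (M ⊓ N) := by
  have := hM.normal
  have := hN.normal
  obtain ⟨j, hj⟩ := hM.exists_index_eq
  refine hN.of_relIndex_dvd inferInstance inf_le_right (j := j) ?_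
  rw [Subgroup.inf_relIndex_right, ← hj]
  exact Subgroup.relIndex_dvd_index_of_normal _ _

instance : SemilatticeInf (PNormal p F) := Subtype.semilatticeInf fun _ _ hM hN => hM.inf hN

instance (N : PNormal p F) : Finite (F ⧸ N.1) := by
  obtain ⟨j, hj⟩ := N.2.exists_index_eq
  have : N.1.FiniteIndex := ⟨hj ▸ pow_ne_zero _ hp.out.ne_zero⟩
  exact Subgroup.finite_quotient_of_finiteIndex

theorem exists_zpow_mem_iff_dvd (N : PNormal p F) (γ : F) :
    ∃ r : ℕ, ∀ a : ℤ, γ ^ a ∈ N.1 ↔ (p : ℤ) ^ r ∣ a := by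
  obtain ⟨j, hj⟩ := N.2.exists_index_eq
  have h : orderOf (γ : F ⧸ N.1) ∣ p ^ j := hj ▸ orderOf_dvd_natCard _
  obtain ⟨r, -, hr⟩ := (Nat.dvd_prime_pow hp.out).1 h
  refine ⟨r, fun a => ?_⟩
  rw [← Nat.cast_pow, ← hr, orderOf_dvd_iff_zpow_eq_one, ← QuotientGroup.eq_one_iff,
    QuotientGroup.mk_zpow]

theorem IsResiduallyP.eventually_notMem (hF : IsResiduallyP p F) {g : F} (hg : g ≠ 1) :
    ∀ᶠ N : PNormal p F in atBot, g ∉ N.1 := by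
  obtain ⟨N, hN, hgN⟩ := hF g hg
  exact eventually_atBot.2 ⟨⟨N, hN⟩, fun M hMN hgM => hgN (hMN hgM)⟩

end PNormal

section FoxDerivation

open scoped MonoidAlgebra

open MonoidAlgebra (of)

variable {F Q : Type*} [Group F] [Group Q]

/-- A Fox derivation: a 1-cocycle of `F` with values in the group ring of `Q`, on which `F` acts
through `π` by left multiplication. -/
def IsFoxDerivation (π : F →* Q) (D : F → ℤ[Q]) : Prop :=
  ∀ z w, D (z * w) = D z + of ℤ Q (π z) * D w

theorem coeff_of_mul (g : Q) (a : ℤ[Q]) (q : Q) : (of ℤ Q g * a).coeff q = a.coeff (g⁻¹ * q) := by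
  simp

namespace IsFoxDerivation

variable {π : F →* Q} {D : F → ℤ[Q]} (hD : IsFoxDerivation π D)
include hD

theorem map_one : D 1 = 0 := by
  have h := hD 1 1
  rwa [mul_one, _root_.map_one, _root_.map_one, one_mul, left_eq_add] at h

theorem map_inv (z : F) : D z⁻¹ = -(of ℤ Q (π z)⁻¹ * D z) := by
  have h := hD z⁻¹ z
  rw [inv_mul_cancel, hD.map_one, _root_.map_inv] at h
  exact eq_neg_of_add_eq_zero_left h.symm

theorem map_mul_of_mem_ker {z : F} (hz : z ∈ π.ker) (w : F) : D (z * w) = D z + D w := by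
  rw [hD, MonoidHom.mem_ker.1 hz, _root_.map_one, one_mul]

theorem map_pow (z : F) (n : ℕ) :
    D (z ^ n) = ∑ i ∈ Finset.range n, of ℤ Q (π z ^ i) * D z := by
  induction n with
  | zero => simp [hD.map_one]
  | succ n ih => rw [pow_succ, hD, ih, Finset.sum_range_succ, _root_.map_pow]

theorem coeff_map_pow {γ : F} {v : Q} (hγ : D γ = 1 - of ℤ Q v) (n : ℕ) (q : Q) :
    (D (γ ^ n)).coeff q = ∑ i ∈ Finset.range n,
      (Finsupp.single (π γ ^ i) 1 q - Finsupp.single (π γ ^ i * v) 1 q) := by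
  simp only [hD.map_pow, hγ, mul_sub, mul_one, MonoidAlgebra.coeff_sum,
    MonoidAlgebra.coeff_sub, Finsupp.finsetSum_apply, Finsupp.sub_apply, MonoidAlgebra.of_apply,
    MonoidAlgebra.single_mul_single, MonoidAlgebra.coeff_single]

theorem map_inv_of_mem_ker {z : F} (hz : z ∈ π.ker) : D z⁻¹ = -D z := by
  rw [hD.map_inv, MonoidHom.mem_ker.1 hz, inv_one, _root_.map_one, one_mul]

theorem map_zpow_of_mem_ker {z : F} (hz : z ∈ π.ker) (a : ℤ) : D (z ^ a) = a • D z := by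
  have h (n : ℕ) : D (z ^ n) = n • D z := by
    simp [hD.map_pow, MonoidHom.mem_ker.1 hz, -MonoidAlgebra.of_apply]
  obtain ⟨n, rfl | rfl⟩ := a.eq_nat_or_neg
  · rw [zpow_natCast, h, natCast_zsmul]
  · rw [zpow_neg, zpow_natCast, hD.map_inv_of_mem_ker (pow_mem hz n), h, neg_smul, natCast_zsmul]

theorem map_conj_of_mem_ker (u : F) {z : F} (hz : z ∈ π.ker) :
    D (u * z * u⁻¹) = of ℤ Q (π u) * D z := by
  have h := hD.map_mul_of_mem_ker (π.normal_ker.conj_mem z hz u) u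
  rw [inv_mul_cancel_right, hD, add_comm] at h
  exact (add_right_cancel h).symm

theorem map_zpow_mul_conj_mul {z : F} (hz : z ∈ π.ker) (u n : F) (a b : ℤ) :
    D (z ^ a * (u * z ^ b * u⁻¹) * n) = a • D z + b • (of ℤ Q (π u) * D z) + D n := by
  have hb : z ^ b ∈ π.ker := zpow_mem hz b
  have hconj := π.normal_ker.conj_mem _ hb u
  rw [hD.map_mul_of_mem_ker (mul_mem (zpow_mem hz a) hconj),
    hD.map_mul_of_mem_ker (zpow_mem hz a), hD.map_zpow_of_mem_ker hz, hD.map_conj_of_mem_ker u hb,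
    hD.map_zpow_of_mem_ker hz, mul_smul_comm]

theorem comp {Q' : Type*} [Group Q'] (ρ : Q →* Q') :
    IsFoxDerivation (ρ.comp π) fun z => MonoidAlgebra.mapDomainRingHom ℤ ρ (D z) := fun z w => by
  beta_reduce
  rw [hD, _root_.map_add, _root_.map_mul]
  simp

/-- The elements of the kernel of `π` on which the derivation vanishes modulo `n`. -/
def kerMod (n : ℕ) : Subgroup F where
  carrier := {z | z ∈ π.ker ∧ ∀ q, (n : ℤ) ∣ (D z).coeff q}
  one_mem' := ⟨one_mem _, by simp [hD.map_one]⟩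
  mul_mem' {z w} hz hw := ⟨mul_mem hz.1 hw.1, fun q => by
    simpa [hD.map_mul_of_mem_ker hz.1] using dvd_add (hz.2 q) (hw.2 q)⟩
  inv_mem' {z} hz := ⟨inv_mem hz.1, fun q => by simpa [hD.map_inv_of_mem_ker hz.1] using hz.2 q⟩

theorem mem_kerMod {n : ℕ} {z : F} :
    z ∈ hD.kerMod n ↔ z ∈ π.ker ∧ ∀ q, (n : ℤ) ∣ (D z).coeff q := Iff.rfl

theorem dvd_coeff_sub_of_inv_mul_mem_kerMod {n : ℕ} {z w : F} (h : z⁻¹ * w ∈ hD.kerMod n) (q : Q) :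
    (n : ℤ) ∣ (D w).coeff q - (D z).coeff q := by
  have := hD z (z⁻¹ * w)
  rw [mul_inv_cancel_left] at this
  rw [this, MonoidAlgebra.coeff_add, Finsupp.add_apply, add_sub_cancel_left, coeff_of_mul]
  exact h.2 _

theorem normal_kerMod (n : ℕ) : (hD.kerMod n).Normal where
  conj_mem z hz u := ⟨π.normal_ker.conj_mem z hz.1 u, fun q => by
    rw [hD.map_conj_of_mem_ker u hz.1, coeff_of_mul]
    exact hz.2 _⟩

theorem relIndex_kerMod_dvd [Finite Q] (n : ℕ) [NeZero n] :
    (hD.kerMod n).relIndex π.ker ∣ n ^ Nat.card Q := by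
  let f : π.ker →* Multiplicative (Q → ZMod n) :=
    MonoidHom.mk' (fun z => .ofAdd fun q => ((D z).coeff q : ZMod n)) fun z w => by
      rw [← ofAdd_add]
      congr 1
      ext q
      simp [hD.map_mul_of_mem_ker z.2]
  have hf : (hD.kerMod n).subgroupOf π.ker = f.ker := by
    ext z
    simp [f, Subgroup.mem_subgroupOf, hD.mem_kerMod, MonoidHom.mem_ker, funext_iff,
      ZMod.intCast_zmod_eq_zero_iff_dvd]
  have hcard : Nat.card (Multiplicative (Q → ZMod n)) = n ^ Nat.card Q := by
    rw [Nat.card_congr Multiplicative.toAdd, Nat.card_fun, Nat.card_zmod]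
  rw [Subgroup.relIndex, hf, Subgroup.index_ker, ← hcard]
  exact Subgroup.card_subgroup_dvd_card _

theorem isPNormal_kerMod {p : ℕ} [hp : Fact p.Prime] [Finite Q] (hπ : IsPNormal p π.ker) (k : ℕ) :
    IsPNormal p (hD.kerMod (p ^ k)) := by
  refine hπ.of_relIndex_dvd (hD.normal_kerMod _) (fun z hz => hz.1) (j := k * Nat.card Q) ?_
  have : NeZero (p ^ k) := ⟨pow_ne_zero _ hp.out.ne_zero⟩
  rw [pow_mul]
  exact hD.relIndex_kerMod_dvd _

end IsFoxDerivation

end FoxDerivation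

section BoundaryElement

open Filter Subgroup

open scoped MonoidAlgebra

open MonoidAlgebra (of)

variable {F : Type*} [Group F]

/-- An abstraction of the class `γ` of the boundary of a compact orientable surface with one
boundary component: `1 - v` and `1 - w` are values at `γ` of Fox derivations, for two elements `v`
and `w` that represent distinct nontrivial cosets of `⟨γ⟩`. -/
def IsBoundaryElement (γ : F) : Prop :=
  ∃ v w : F, v ∉ zpowers γ ∧ w ∉ zpowers γ ∧ v * w⁻¹ ∉ zpowers γ ∧
    ∀ u ∈ ({v, w} : Set F), ∃ D, IsFoxDerivation (.id F) D ∧ D γ = 1 - of ℤ F u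

section CoeffSum

/-- The sum of the coefficients of an element of the group ring at the elements of a subgroup. -/
noncomputable def coeffSum (H : Subgroup F) : ℤ[F] →+ ℤ :=
  MonoidAlgebra.liftNC (.id ℤ) ((H : Set F).indicator 1)

variable {H : Subgroup F}

theorem coeffSum_of_of_mem {g : F} (hg : g ∈ H) : coeffSum H (of ℤ F g) = 1 := by
  simp [coeffSum, hg]

theorem coeffSum_of_of_notMem {g : F} (hg : g ∉ H) : coeffSum H (of ℤ F g) = 0 := by
  simp [coeffSum, hg]

theorem coeffSum_of_nonneg (g : F) : 0 ≤ coeffSum H (of ℤ F g) := by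
  by_cases hg : g ∈ H
  · rw [coeffSum_of_of_mem hg]
    exact zero_le_one
  · rw [coeffSum_of_of_notMem hg]

theorem coeffSum_of_mul {g : F} (hg : g ∈ H) (a : ℤ[F]) :
    coeffSum H (of ℤ F g * a) = coeffSum H a := by
  suffices (coeffSum H).comp (AddMonoidHom.mulLeft (of ℤ F g)) = coeffSum H from
    DFunLike.congr_fun this a
  ext x
  simpa [coeffSum] using Set.indicator_eq_indicator (H.mul_mem_cancel_left hg) rfl

end CoeffSum

namespace IsBoundaryElement

variable {γ : F}

theorem mem_zpowers_of_commute (hγ : IsBoundaryElement γ) {h : F} (hc : Commute h γ) :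
    h ∈ zpowers γ := by
  obtain ⟨v, _, hv, -, -, hDv⟩ := hγ
  obtain ⟨D, hD, hDγ⟩ := hDv v (by simp)
  by_contra hh
  have heq : D h + of ℤ F h * (1 - of ℤ F v) = (1 - of ℤ F v) + of ℤ F γ * D h := by
    rw [← hDγ]
    exact (hD h γ).symm.trans ((congrArg D hc.eq).trans (hD γ h))
  have hsum := congrArg (coeffSum (zpowers γ)) heq
  rw [mul_sub, mul_one, ← map_mul, ← map_one (of ℤ F), map_add, map_add, map_sub, map_sub,
    coeffSum_of_mul (mem_zpowers γ), coeffSum_of_of_notMem hh, coeffSum_of_of_notMem hv,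
    coeffSum_of_of_mem (one_mem _)] at hsum
  linarith [coeffSum_of_nonneg (H := zpowers γ) (h * v)]

theorem exists_foxDerivation (hγ : IsBoundaryElement γ) (h : F) :
    ∃ v D, v ∉ zpowers γ ∧ v * h ∉ zpowers γ ∧ IsFoxDerivation (.id F) D ∧
      D γ = 1 - of ℤ F v := by
  obtain ⟨v, w, hv, hw, hvw, hD⟩ := hγ
  by_cases hvh : v * h ∈ zpowers γ
  · obtain ⟨D, hDw⟩ := hD w (by simp)
    refine ⟨w, D, hw, fun hwh => hvw ?_, hDw⟩
    simpa [mul_assoc] using mul_mem hvh (inv_mem hwh)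
  · obtain ⟨D, hDv⟩ := hD v (by simp)
    exact ⟨v, D, hv, hvh, hDv⟩

variable {p : ℕ} [hp : Fact p.Prime]

theorem eventually_forall_zpow_mul_notMem (hγ : IsBoundaryElement γ) (hF : IsResiduallyP p F)
    {h : F} (hh : h ∉ zpowers γ) :
    ∀ᶠ N : PNormal p F in atBot, ∀ a : ℤ, γ ^ a * h ∉ N.1 := by
  have hne : h * γ * h⁻¹ * γ⁻¹ ≠ 1 := fun h1 => hh (hγ.mem_zpowers_of_commute
    (by rwa [mul_inv_eq_one, mul_inv_eq_iff_eq_mul] at h1))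
  filter_upwards [hF.eventually_notMem hne] with N hN a ha
  refine hN ?_
  rw [← QuotientGroup.eq_one_iff, QuotientGroup.mk_mul, QuotientGroup.mk_zpow,
    mul_eq_one_iff_inv_eq] at ha
  rw [← QuotientGroup.eq_one_iff]
  simp only [QuotientGroup.mk_mul, QuotientGroup.mk_inv, ← ha]
  group

end IsBoundaryElement

end BoundaryElement

section Separation

open Filter Subgroup

open scoped MonoidAlgebra

open MonoidAlgebra (of)

variable {F : Type*} [Group F]

theorem zpow_mul_conj_mem {N : Subgroup F} [N.Normal] {γ h : F} {a b : ℤ}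
    (hab : γ ^ a * (h * γ ^ b * h⁻¹) ∈ N) (n : ℕ) :
    (γ ^ n) ^ a * (h * (γ ^ n) ^ b * h⁻¹) ∈ N := by
  have hpow (a : ℤ) : (γ ^ n) ^ a = (γ ^ a) ^ n := by simp_rw [← zpow_natCast, zpow_comm γ]
  rw [← QuotientGroup.eq_one_iff, QuotientGroup.mk_mul] at hab ⊢
  rw [hpow, hpow, ← conj_pow, QuotientGroup.mk_pow, QuotientGroup.mk_pow,
    eq_inv_of_mul_eq_one_left hab, inv_pow, inv_mul_cancel]

/-- Two coefficients of the Fox derivation `D` separate the classes of `ζ` and of `u ζ u⁻¹` in the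
abelianization of the kernel of `π`, even modulo any integer. -/
structure SeparatesConj {Q : Type*} [Group Q] (π : F →* Q) (D : F → ℤ[Q]) (ζ u : F) : Prop where
  isFoxDerivation : IsFoxDerivation π D
  mem_ker : ζ ∈ π.ker
  coeff_one : (D ζ).coeff 1 = 1
  coeff_inv : (D ζ).coeff (π u)⁻¹ = 0

theorem IsFoxDerivation.separatesConj {Q : Type*} [Group Q] {π : F →* Q} {D : F → ℤ[Q]}
    (hD : IsFoxDerivation π D) {γ u : F} {v : Q} (hDγ : D γ = 1 - of ℤ Q v)
    (hγ : 0 < orderOf (π γ)) (hv : v ∉ zpowers (π γ)) (hu : π u ∉ zpowers (π γ))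
    (hvu : v * π u ∉ zpowers (π γ)) : SeparatesConj π D (γ ^ orderOf (π γ)) u := by
  refine ⟨hD, by rw [MonoidHom.mem_ker, _root_.map_pow, pow_orderOf_eq_one], ?_, ?_⟩
  · rw [hD.coeff_map_pow hDγ, Finset.sum_eq_single_of_mem 0 (Finset.mem_range.2 hγ)]
    · rw [pow_zero, one_mul, Finsupp.single_eq_same, Finsupp.single_eq_of_ne', sub_zero]
      rintro rfl
      exact hv (one_mem _)
    · intro i hi hi0
      rw [Finsupp.single_eq_of_ne', Finsupp.single_eq_of_ne', sub_zero]
      · intro h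
        exact hv ((Subgroup.mul_mem_cancel_left _ (npow_mem_zpowers _ i)).1 (h ▸ one_mem _))
      · exact pow_ne_one_of_lt_orderOf hi0 (Finset.mem_range.1 hi)
  · rw [hD.coeff_map_pow hDγ]
    refine Finset.sum_eq_zero fun i _ => ?_
    have hi := npow_mem_zpowers (π γ) i
    rw [Finsupp.single_eq_of_ne', Finsupp.single_eq_of_ne', sub_zero] <;>
      rw [Ne, eq_inv_iff_mul_eq_one] <;> intro h
    · rw [mul_assoc] at h
      exact hvu ((Subgroup.mul_mem_cancel_left _ hi).1 (h ▸ one_mem _))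
    · exact hu ((Subgroup.mul_mem_cancel_left _ hi).1 (h ▸ one_mem _))

namespace SeparatesConj

variable {Q : Type*} [Group Q] {π : F →* Q} {D : F → ℤ[Q]} {ζ u : F} (hD : SeparatesConj π D ζ u)
include hD

theorem exists_forall_dvd (n : F) :
    ∃ α β : ℤ, ∀ (m : ℕ) (a b : ℤ),
      ζ ^ a * (u * ζ ^ b * u⁻¹) * n ∈ hD.isFoxDerivation.kerMod m →
        (m : ℤ) ∣ a - α ∧ (m : ℤ) ∣ b - β := by
  refine ⟨-(D n).coeff 1, (D n).coeff 1 * (D ζ).coeff (π u) - (D n).coeff (π u),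
    fun m a b h => ?_⟩
  have hcoeff (q : Q) : (m : ℤ) ∣ a * (D ζ).coeff q + b * (D ζ).coeff ((π u)⁻¹ * q) +
      (D n).coeff q := by
    have := h.2 q
    rwa [hD.isFoxDerivation.map_zpow_mul_conj_mul hD.mem_ker, MonoidAlgebra.coeff_add,
      MonoidAlgebra.coeff_add, Finsupp.add_apply, Finsupp.add_apply, MonoidAlgebra.coeff_smul_apply,
      MonoidAlgebra.coeff_smul_apply, coeff_of_mul] at this
  have ha : (m : ℤ) ∣ a - -(D n).coeff 1 := by
    simpa [hD.coeff_one, hD.coeff_inv] using hcoeff 1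
  refine ⟨ha, ?_⟩
  have hb := hcoeff (π u)
  rw [inv_mul_cancel, hD.coeff_one] at hb
  have hab := dvd_sub hb (ha.mul_right ((D ζ).coeff (π u)))
  ring_nf at hab ⊢
  exact hab

theorem dvd_of_conj_mem_kerMod {m : ℕ} {a b : ℤ}
    (h : ζ ^ a * (u * ζ ^ b * u⁻¹) ∈ hD.isFoxDerivation.kerMod m) :
    (m : ℤ) ∣ a ∧ (m : ℤ) ∣ b := by
  obtain ⟨α, β, hαβ⟩ := hD.exists_forall_dvd 1
  obtain ⟨hα, hβ⟩ := hαβ m 0 0 (by simp)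
  obtain ⟨ha, hb⟩ := hαβ m a b (by rwa [mul_one])
  rw [zero_sub, dvd_neg] at hα hβ
  exact ⟨(dvd_sub_left hα).1 ha, (dvd_sub_left hβ).1 hb⟩

theorem zpow_mem_kerMod {m : ℕ} {a : ℤ} : ζ ^ a ∈ hD.isFoxDerivation.kerMod m ↔ (m : ℤ) ∣ a := by
  refine ⟨fun h => (hD.dvd_of_conj_mem_kerMod (b := 0) (by simpa using h)).1, fun h =>
    ⟨zpow_mem hD.mem_ker a, fun q => ?_⟩⟩
  rw [hD.isFoxDerivation.map_zpow_of_mem_ker hD.mem_ker, MonoidAlgebra.coeff_smul_apply]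
  exact h.mul_right _

end SeparatesConj

section PNormal

variable {p : ℕ} {N : PNormal p F} {D : F → ℤ[F ⧸ N.1]} {ζ u : F}

namespace SeparatesConj

/-- The subgroup `kerMod` modulo `p ^ k`, as an open normal subgroup of the pro-`p` topology. -/
def pNormal [Fact p.Prime] (hD : SeparatesConj (QuotientGroup.mk' N.1) D ζ u) (k : ℕ) :
    PNormal p F :=
  ⟨hD.isFoxDerivation.kerMod (p ^ k),
    hD.isFoxDerivation.isPNormal_kerMod ((QuotientGroup.ker_mk' N.1).symm ▸ N.2) k⟩

theorem pNormal_le [Fact p.Prime] (hD : SeparatesConj (QuotientGroup.mk' N.1) D ζ u) (k : ℕ) :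
    hD.pNormal k ≤ N :=
  fun _ hz => (QuotientGroup.eq_one_iff _).1 hz.1

end SeparatesConj

end PNormal

namespace IsBoundaryElement

variable {γ : F} {p : ℕ} [hp : Fact p.Prime]

theorem eventually_exists_separatesConj (hγ : IsBoundaryElement γ) (hF : IsResiduallyP p F)
    {h : F} (hh : h ∉ zpowers γ) :
    ∀ᶠ N : PNormal p F in atBot, ∀ r : ℕ, (∀ a : ℤ, γ ^ a ∈ N.1 ↔ (p : ℤ) ^ r ∣ a) →
      ∃ D, SeparatesConj (QuotientGroup.mk' N.1) D (γ ^ p ^ r) h := by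
  obtain ⟨v, D, hv, hvh, hD, hDγ⟩ := hγ.exists_foxDerivation h
  filter_upwards [hγ.eventually_forall_zpow_mul_notMem hF hh,
    hγ.eventually_forall_zpow_mul_notMem hF hv,
    hγ.eventually_forall_zpow_mul_notMem hF hvh] with N hhN hvN hvhN r hr
  have hnot {z : F} (hz : ∀ a : ℤ, γ ^ a * z ∉ N.1) :
      QuotientGroup.mk' N.1 z ∉ zpowers (QuotientGroup.mk' N.1 γ) := by
    rintro ⟨a, ha⟩
    refine hz (-a) ?_
    rw [zpow_neg]
    exact QuotientGroup.eq.1 ha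
  have horder : orderOf (QuotientGroup.mk' N.1 γ) = p ^ r := by
    refine Nat.dvd_right_iff_eq.1 fun n => ?_
    rw [orderOf_dvd_iff_pow_eq_one, ← map_pow, QuotientGroup.mk'_apply, QuotientGroup.eq_one_iff,
      ← zpow_natCast, hr, ← Nat.cast_pow, Int.natCast_dvd_natCast]
  have hD' := hD.comp (QuotientGroup.mk' N.1)
  rw [MonoidHom.comp_id] at hD'
  rw [← horder]
  exact ⟨_, hD'.separatesConj (v := QuotientGroup.mk' N.1 v) (by rw [hDγ, map_sub, map_one]; simp)
    (by rw [horder]; exact pow_pos hp.out.pos r) (hnot hvN) (hnot hhN) (hnot hvhN)⟩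

theorem exists_separatesConj_le (hγ : IsBoundaryElement γ) (hF : IsResiduallyP p F) {h : F}
    (hh : h ∉ zpowers γ) (M : PNormal p F) :
    ∃ N ≤ M, ∃ r : ℕ, (∀ a : ℤ, γ ^ a ∈ N.1 ↔ (p : ℤ) ^ r ∣ a) ∧
      ∃ D, SeparatesConj (QuotientGroup.mk' N.1) D (γ ^ p ^ r) h := by
  obtain ⟨N, hN, hNM⟩ :=
    ((hγ.eventually_exists_separatesConj hF hh).and (eventually_le_atBot M)).exists
  obtain ⟨r, hr⟩ := exists_zpow_mem_iff_dvd N γ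
  exact ⟨N, hNM, r, hr, hN r hr⟩

theorem eventually_exists_zpow_mem_iff_dvd (hγ : IsBoundaryElement γ) (hF : IsResiduallyP p F)
    (N : PNormal p F) :
    ∀ᶠ R : ℕ in atTop, ∃ M ≤ N, ∀ a : ℤ, γ ^ a ∈ M.1 ↔ (p : ℤ) ^ R ∣ a := by
  obtain ⟨v, -, hv, -⟩ := id hγ
  obtain ⟨M, hMN, r, hr, D, hD⟩ := hγ.exists_separatesConj_le hF hv N
  filter_upwards [eventually_ge_atTop r] with R hR
  obtain ⟨k, rfl⟩ := Nat.exists_eq_add_of_le hR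
  refine ⟨hD.pNormal k, (hD.pNormal_le k).trans hMN, fun a => ⟨fun ha => ?_, ?_⟩⟩
  · obtain ⟨b, rfl⟩ := (hr a).1 (hD.pNormal_le k ha)
    rw [pow_add]
    refine mul_dvd_mul_left _ ?_
    rw [← Nat.cast_pow, zpow_mul, zpow_natCast] at ha
    exact_mod_cast hD.zpow_mem_kerMod.1 ha
  · rintro ⟨b, rfl⟩
    rw [pow_add, mul_assoc, ← Nat.cast_pow, zpow_mul, zpow_natCast]
    exact hD.zpow_mem_kerMod.2 (by exact_mod_cast dvd_mul_right _ _)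

theorem zpowersHom_injective (hγ : IsBoundaryElement γ) (hF : IsResiduallyP p F) :
    Function.Injective (zpowersHom F γ) := by
  refine (injective_iff_map_eq_one (zpowersHom F γ)).2 fun a ha => ?_
  obtain ⟨R, ⟨M, -, hM⟩, hR⟩ := ((hγ.eventually_exists_zpow_mem_iff_dvd hF
    (Classical.arbitrary _)).and ((tendsto_pow_atTop_atTop_of_one_lt
      (by exact_mod_cast hp.out.one_lt : (1 : ℤ) < p)).eventually_gt_atTop |a.toAdd|)).exists
  exact Int.eq_zero_of_abs_lt_dvd ((hM a.toAdd).1 ((congrArg (· ∈ M.1) ha).mpr (one_mem _))) hR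

theorem eventually_forall_dvd (hγ : IsBoundaryElement γ) (hF : IsResiduallyP p F) {h : F}
    (hh : h ∉ zpowers γ) (K : ℕ) :
    ∀ᶠ M : PNormal p F in atBot, ∀ a b : ℤ, γ ^ a * (h * γ ^ b * h⁻¹) ∈ M.1 →
      (p : ℤ) ^ K ∣ a ∧ (p : ℤ) ^ K ∣ b := by
  obtain ⟨N, -, r, -, D, hD⟩ := exists_separatesConj_le hγ hF hh (Classical.arbitrary _)
  filter_upwards [eventually_le_atBot (hD.pNormal K)] with M hM a b hab
  have := hD.dvd_of_conj_mem_kerMod (hM (zpow_mul_conj_mem hab (p ^ r)))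
  exact_mod_cast this

end IsBoundaryElement

end Separation

section DoubleCoset

open Filter Subgroup

variable {F : Type*} [Group F] {γ : F} {p : ℕ} [hp : Fact p.Prime]

theorem mk_zpow_eq_mk_zpow_iff {N : Subgroup F} [N.Normal] {m : ℤ}
    (hm : ∀ a : ℤ, γ ^ a ∈ N ↔ m ∣ a) {a b : ℤ} :
    ((γ ^ a : F) : F ⧸ N) = (γ ^ b : F) ↔ m ∣ b - a := by
  rw [QuotientGroup.eq, ← zpow_neg, ← zpow_add, hm, neg_add_eq_sub]

namespace IsBoundaryElement

theorem exists_forall_notMem_of_mul_inv_mem (hγ : IsBoundaryElement γ) (hF : IsResiduallyP p F)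
    {h : F} (hh : h ∉ zpowers γ) :
    ∃ M : PNormal p F, ∀ g, (∀ a b : ℤ, γ ^ a * h * γ ^ b ≠ g) → h * g⁻¹ ∈ M.1 →
      ∃ N : PNormal p F, ∀ a b : ℤ, γ ^ a * h * γ ^ b * g⁻¹ ∉ N.1 := by
  obtain ⟨N, -, r, -, D, hD⟩ := hγ.exists_separatesConj_le hF hh (Classical.arbitrary _)
  obtain ⟨M, hM⟩ := (hγ.eventually_forall_dvd hF hh r).exists
  refine ⟨M, fun g hg hgM => ?_⟩
  obtain ⟨α, β, hαβ⟩ := hD.exists_forall_dvd (h * g⁻¹)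
  obtain ⟨R, hR⟩ := (hF.eventually_notMem (mul_inv_eq_one.not.2
    (hg ((p : ℤ) ^ r * α) ((p : ℤ) ^ r * β)))).exists
  obtain ⟨k, hk⟩ := exists_zpow_mem_iff_dvd R γ
  refine ⟨M ⊓ R ⊓ hD.pNormal k, fun a b hab => hR ?_⟩
  have hsplit : γ ^ a * h * γ ^ b * g⁻¹ = γ ^ a * (h * γ ^ b * h⁻¹) * (h * g⁻¹) := by group
  have habM : γ ^ a * (h * γ ^ b * h⁻¹) ∈ M.1 :=
    (Subgroup.mul_mem_cancel_right _ hgM).1 (hsplit ▸ hab.1.1)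
  obtain ⟨⟨a, rfl⟩, b, rfl⟩ := hM a b habM
  have hζ (c : ℤ) : (γ ^ p ^ r) ^ c = γ ^ ((p : ℤ) ^ r * c) := by
    rw [← zpow_natCast, ← zpow_mul, Nat.cast_pow]
  obtain ⟨hα, hβ⟩ := hαβ (p ^ k) a b (by rw [hζ, hζ, ← hsplit]; exact hab.2)
  rw [Nat.cast_pow] at hα hβ
  have hmk {a α : ℤ} (h : (p : ℤ) ^ k ∣ a - α) :
      ((γ ^ ((p : ℤ) ^ r * α) : F) : F ⧸ R.1) = (γ ^ ((p : ℤ) ^ r * a) : F) :=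
    (mk_zpow_eq_mk_zpow_iff hk).2 (by rw [← mul_sub]; exact h.mul_left _)
  have habR := (QuotientGroup.eq_one_iff _).2 hab.1.2
  rw [← QuotientGroup.eq_one_iff]
  simp only [QuotientGroup.mk_mul] at habR ⊢
  rwa [hmk hα, hmk hβ]

theorem exists_forall_notMem (hγ : IsBoundaryElement γ) (hF : IsResiduallyP p F) {g h : F}
    (hh : h ∉ zpowers γ) (hg : ∀ a b : ℤ, γ ^ a * h * γ ^ b ≠ g) :
    ∃ N : PNormal p F, ∀ a b : ℤ, γ ^ a * h * γ ^ b * g⁻¹ ∉ N.1 := by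
  obtain ⟨M, hM⟩ := hγ.exists_forall_notMem_of_mul_inv_mem hF hh
  by_cases hgM : ∃ a b : ℤ, γ ^ a * h * γ ^ b * g⁻¹ ∈ M.1
  · obtain ⟨a₀, b₀, hab₀⟩ := hgM
    obtain ⟨N, hN⟩ := hM (γ ^ (-a₀) * g * γ ^ (-b₀))
      (fun a b hab => hg (a₀ + a) (b + b₀) (by
        rw [zpow_add, zpow_add, mul_assoc (γ ^ a₀), mul_assoc (γ ^ a₀), ← mul_assoc _ (γ ^ b), hab]
        group))
      (by convert M.2.normal.conj_mem _ hab₀ (γ ^ (-a₀)) using 1; group)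
    refine ⟨N, fun a b hab => hN (a - a₀) (b - b₀) ?_⟩
    convert N.2.normal.conj_mem _ hab (γ ^ (-a₀)) using 1
    group
  · push Not at hgM
    exact ⟨M, hgM⟩

theorem exists_forall_eventually_dvd (hγ : IsBoundaryElement γ) (hF : IsResiduallyP p F) {h : F}
    (hh : h ∉ zpowers γ) (g : F) :
    ∃ a₀ b₀ : ℤ, ∀ K : ℕ, ∀ᶠ N : PNormal p F in atBot, ∀ a b : ℤ,
      ((γ ^ a * h : F) : F ⧸ N.1) = (g * γ ^ b : F) →
        γ ^ a₀ * h = g * γ ^ b₀ ∧ (p : ℤ) ^ K ∣ a - a₀ ∧ (p : ℤ) ^ K ∣ b - b₀ := by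
  by_cases hg : ∀ a b : ℤ, γ ^ a * h * γ ^ b ≠ g
  · obtain ⟨N, hN⟩ := hγ.exists_forall_notMem hF hh hg
    refine ⟨0, 0, fun _ => ?_⟩
    filter_upwards [eventually_le_atBot N] with M hM a b hab
    refine absurd (hM (QuotientGroup.eq_iff_div_mem.1 hab)) ?_
    rw [div_eq_mul_inv, mul_inv_rev, ← zpow_neg, ← mul_assoc]
    exact hN a (-b)
  · push Not at hg
    obtain ⟨a₀, b₀, rfl⟩ := hg
    refine ⟨a₀, -b₀, fun K => ?_⟩
    filter_upwards [hγ.eventually_forall_dvd hF hh K] with N hN a b hab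
    refine ⟨by group, ?_⟩
    rw [dvd_sub_comm (b := b)]
    refine hN _ _ ?_
    convert N.2.normal.conj_mem _ (QuotientGroup.eq_iff_div_mem.1 hab) (γ ^ (-a₀)) using 1
    rw [div_eq_mul_inv]
    group

end IsBoundaryElement

end DoubleCoset

/-! ### Free groups -/

section FreeGroup

open FreeGroup (mk)

open MonoidAlgebra (of)

open scoped MonoidAlgebra

variable {X Q : Type*} [Group Q] {π : FreeGroup X →* Q}

theorem exists_isFoxDerivation_of_eq (π : FreeGroup X →* Q) (m : X → ℤ[Q]) :
    ∃ D, IsFoxDerivation π D ∧ ∀ x, D (.of x) = m x := by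
  have hcancel (g : Q) (a : ℤ[Q]) : of ℤ Q g⁻¹ * (of ℤ Q g * a) = a := by
    rw [← mul_assoc, ← map_mul, inv_mul_cancel, map_one, one_mul]
  have hcancel' (g : Q) (a : ℤ[Q]) : of ℤ Q g * (of ℤ Q g⁻¹ * a) = a := by
    rw [← mul_assoc, ← map_mul, mul_inv_cancel, map_one, one_mul]
  -- A Fox derivation is the translation part of an affine action on the group ring.
  let affine (x : X) : Equiv.Perm ℤ[Q] :=
    { toFun := fun a => of ℤ Q (π (.of x)) * a + m x
      invFun := fun a => of ℤ Q (π (.of x))⁻¹ * (a - m x)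
      left_inv := fun a => by simp only [add_sub_cancel_right, hcancel]
      right_inv := fun a => by simp only [hcancel', sub_add_cancel] }
  let Φ := FreeGroup.lift affine
  have hΦ (z : FreeGroup X) : ∀ a b, Φ z a - Φ z b = of ℤ Q (π z) * (a - b) := by
    induction z using FreeGroup.induction_on with
    | C1 => simp only [map_one, Equiv.Perm.one_apply, one_mul, implies_true]
    | of x =>
      intro a b
      simp only [Φ, affine, FreeGroup.lift_apply_of, Equiv.coe_fn_mk, add_sub_add_right_eq_sub,
        mul_sub]
    | inv_of x hx =>
      intro a b
      have := hx (Φ (.of x)⁻¹ a) (Φ (.of x)⁻¹ b)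
      simp only [map_inv, Equiv.Perm.inv_def, Equiv.apply_symm_apply] at this ⊢
      rw [this, hcancel]
    | mul z w hz hw =>
      intro a b
      simp only [map_mul, Equiv.Perm.mul_apply, hz, hw, mul_assoc]
  refine ⟨fun z => Φ z 0, fun z w => ?_, fun x => by simp [Φ, affine]⟩
  have := hΦ z (Φ w 0) 0
  rw [sub_zero] at this
  simp only [← this, map_mul, Equiv.Perm.mul_apply, add_sub_cancel]

section ResiduallyP

/-- The initial vertex of the edge of the Cayley graph that joins `mk s` to `mk (s ++ [c])`, if
edges are oriented according to the generators. -/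
def edgeSource (s : List (X × Bool)) (c : X × Bool) : FreeGroup X :=
  if c.2 then mk s else mk (s ++ [c])

theorem edgeSource_mul_of (s : List (X × Bool)) (c : X × Bool) :
    edgeSource s c * .of c.1 = if c.2 then mk (s ++ [c]) else mk s := by
  obtain ⟨x, _ | _⟩ := c
  · simp only [edgeSource, Bool.false_eq_true, if_false, ← FreeGroup.mul_mk, mul_assoc]
    exact mul_eq_left.2 (inv_mul_cancel (FreeGroup.of x))
  · simp only [edgeSource, if_true, ← FreeGroup.mul_mk]
    rfl

variable {D : FreeGroup X → ℤ[Q]}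

theorem IsFoxDerivation.map_mk_concat (hD : IsFoxDerivation π D) (s : List (X × Bool))
    (c : X × Bool) : D (mk (s ++ [c])) =
      D (mk s) + (if c.2 then 1 else -1 : ℤ) • (of ℤ Q (π (edgeSource s c)) * D (.of c.1)) := by
  have h := hD (edgeSource s c) (.of c.1)
  rw [edgeSource_mul_of] at h
  obtain ⟨x, _ | _⟩ := c
  · rw [if_neg Bool.false_ne_true, edgeSource, if_neg Bool.false_ne_true] at h
    rw [h, edgeSource]
    simp [-MonoidAlgebra.of_apply]
  · rw [if_pos rfl, edgeSource, if_pos rfl] at h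
    rw [h, edgeSource, if_pos rfl, if_pos rfl, one_smul]

theorem map_edgeSource_ne {L s : List (X × Bool)} {a c : X × Bool}
    (hL : FreeGroup.IsReduced (L ++ [a]))
    (hsep : ∀ s t, s <+: L → t <+: L → π (mk s) = π (mk t) → s = t) (hs : s ++ [c] <+: L)
    (hca : c.1 = a.1) : π (edgeSource s c) ≠ π (edgeSource L a) := by
  intro h
  have hs' : s <+: L := (List.prefix_append s [c]).trans hs
  have h' : π (edgeSource s c * .of c.1) = π (edgeSource L a * .of a.1) := by
    rw [map_mul, map_mul, h, hca]
  rw [edgeSource_mul_of, edgeSource_mul_of] at h'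
  have hne : π (mk s) ≠ π (mk L) := fun h => by
    obtain rfl := hsep s L hs' List.prefix_rfl h
    simpa using hs.length_le
  have hne' (hc : c.2 ≠ a.2) : π (mk (s ++ [c])) ≠ π (mk L) := fun h => by
    obtain rfl := hsep _ L hs List.prefix_rfl h
    have hred : FreeGroup.IsReduced [c, a] := hL.infix ⟨s, [], by simp⟩
    exact hc ((FreeGroup.isReduced_cons_cons.1 hred).1 hca)
  obtain ⟨x, _ | _⟩ := c <;> obtain ⟨y, _ | _⟩ := a <;>
    simp only [edgeSource, Bool.false_eq_true, if_false, if_true] at h h'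
  exacts [hne h', hne' Bool.false_ne_true h, hne' Bool.false_ne_true.symm h', hne h]

theorem IsFoxDerivation.coeff_map_mk_eq_zero (hD : IsFoxDerivation π D) {L s : List (X × Bool)}
    {a : X × Bool} (hL : FreeGroup.IsReduced (L ++ [a]))
    (hsep : ∀ s t, s <+: L → t <+: L → π (mk s) = π (mk t) → s = t)
    (hDa : D (.of a.1) = 1) (hDx : ∀ x ≠ a.1, D (.of x) = 0) (hs : s <+: L) :
    (D (mk s)).coeff (π (edgeSource L a)) = 0 := by
  induction s using List.reverseRecOn with
  | nil => rw [← FreeGroup.one_eq_mk, hD.map_one]; rfl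
  | append_singleton s c ih =>
    rw [hD.map_mk_concat, MonoidAlgebra.coeff_add, Finsupp.add_apply,
      ih ((List.prefix_append s [c]).trans hs), zero_add, MonoidAlgebra.coeff_smul_apply]
    by_cases hca : c.1 = a.1
    · rw [hca, hDa, mul_one, MonoidAlgebra.of_apply, MonoidAlgebra.coeff_single,
        Finsupp.single_eq_of_ne' (map_edgeSource_ne hL hsep hs hca), smul_zero]
    · rw [hDx _ hca, mul_zero, MonoidAlgebra.coeff_zero, Finsupp.zero_apply, smul_zero]

theorem IsFoxDerivation.eq_one_of_inv_mul_mk_concat_mem_kerMod (hD : IsFoxDerivation π D)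
    {L t : List (X × Bool)} {a : X × Bool} (hL : FreeGroup.IsReduced (L ++ [a]))
    (hsep : ∀ s t, s <+: L → t <+: L → π (mk s) = π (mk t) → s = t)
    (hDa : D (.of a.1) = 1) (hDx : ∀ x ≠ a.1, D (.of x) = 0) (ht : t <+: L) {n : ℕ}
    (h : (mk t)⁻¹ * mk (L ++ [a]) ∈ hD.kerMod n) : n = 1 := by
  have hcoeff {s} (hs : s <+: L) := hD.coeff_map_mk_eq_zero hL hsep hDa hDx hs
  have hdvd := hD.dvd_coeff_sub_of_inv_mul_mem_kerMod h (π (edgeSource L a))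
  rw [hcoeff ht, sub_zero, hD.map_mk_concat, hDa, mul_one, MonoidAlgebra.coeff_add,
    Finsupp.add_apply, hcoeff List.prefix_rfl, zero_add, MonoidAlgebra.coeff_smul_apply,
    MonoidAlgebra.of_apply, MonoidAlgebra.coeff_single, Finsupp.single_eq_same] at hdvd
  have hunit : IsUnit ((if a.2 then 1 else -1 : ℤ) • (1 : ℤ)) := by split_ifs <;> simp
  exact Nat.isUnit_iff.1 (Int.ofNat_isUnit.1 (isUnit_of_dvd_unit hdvd hunit))

variable {p : ℕ} [hp : Fact p.Prime]

theorem exists_pNormal_forall_prefix {L : List (X × Bool)} (hL : FreeGroup.IsReduced L) :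
    ∃ N : PNormal p (FreeGroup X), ∀ s t, s <+: L → t <+: L →
      (mk s : FreeGroup X ⧸ N.1) = mk t → s = t := by
  classical
  induction L using List.reverseRecOn with
  | nil =>
    exact ⟨Classical.arbitrary _, fun s t hs ht _ => by
      rw [List.prefix_nil.1 hs, List.prefix_nil.1 ht]⟩
  | append_singleton L a ih =>
    obtain ⟨N, hsep⟩ := ih (hL.infix (List.prefix_append L [a]).isInfix)
    obtain ⟨D, hD, hDx⟩ := exists_isFoxDerivation_of_eq (QuotientGroup.mk' N.1) (Pi.single a.1 1)
    have hM : IsPNormal p (hD.kerMod (p ^ 1)) :=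
      hD.isPNormal_kerMod (by rw [QuotientGroup.ker_mk']; exact N.2) 1
    have hlast {t} (ht : t <+: L) : (mk t)⁻¹ * mk (L ++ [a]) ∉ hD.kerMod (p ^ 1) := fun hmem => by
      have := hD.eq_one_of_inv_mul_mk_concat_mem_kerMod hL hsep (by simp [hDx])
        (fun x hx => by simp [hDx, hx]) ht hmem
      exact hp.out.ne_one (by rwa [pow_one] at this)
    refine ⟨⟨_, hM⟩, fun s t hs ht hst => ?_⟩
    rw [QuotientGroup.eq] at hst
    rcases List.prefix_concat_iff.1 hs with rfl | hs <;>
      rcases List.prefix_concat_iff.1 ht with rfl | ht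
    · rfl
    · exact absurd (by simpa using inv_mem hst) (hlast ht)
    · exact absurd hst (hlast hs)
    · exact hsep s t hs ht (QuotientGroup.eq.2 (by simpa using hst.1))

theorem freeGroup_isResiduallyP : IsResiduallyP p (FreeGroup X) := by
  classical
  intro g hg
  obtain ⟨N, hsep⟩ := exists_pNormal_forall_prefix (p := p) (FreeGroup.isReduced_toWord (x := g))
  refine ⟨N.1, N.2, fun hgN => hg ?_⟩
  rw [← FreeGroup.toWord_eq_nil_iff]
  refine hsep _ _ List.prefix_rfl List.nil_prefix ?_
  rwa [FreeGroup.mk_toWord, ← FreeGroup.one_eq_mk, QuotientGroup.mk_one,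
    QuotientGroup.eq_one_iff]

end ResiduallyP

section Commutator

theorem IsFoxDerivation.map_eq_zero_of_mem_closure {D : FreeGroup X → ℤ[Q]}
    (hD : IsFoxDerivation π D) {s : Set X} (hs : ∀ z ∈ s, D (.of z) = 0) {δ : FreeGroup X}
    (hδ : δ ∈ Subgroup.closure (FreeGroup.of '' s)) : D δ = 0 := by
  induction hδ using Subgroup.closure_induction with
  | mem u hu => obtain ⟨z, hz, rfl⟩ := hu; exact hs z hz
  | one => exact hD.map_one
  | mul u w _ _ hu hw => rw [hD, hu, hw, mul_zero, add_zero]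
  | inv u _ hu => rw [hD.map_inv, hu, mul_zero, neg_zero]

theorem notMem_zpowers_of_map_ne_one {F A : Type*} [Group F] [Group A] (f : F →* A) {γ v : F}
    (hγ : f γ = 1) (hv : f v ≠ 1) : v ∉ Subgroup.zpowers γ := by
  rintro ⟨a, rfl⟩
  exact hv (by rw [map_zpow, hγ, one_zpow])

theorem isBoundaryElement_commutator_mul {x y : X} (hxy : x ≠ y) {δ : FreeGroup X}
    (hδ : δ ∈ Subgroup.closure (FreeGroup.of '' {x, y}ᶜ)) :
    IsBoundaryElement (.of x * .of y * (.of x)⁻¹ * (.of y)⁻¹ * δ) := by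
  classical
  let f : FreeGroup X →* Multiplicative (ℤ × ℤ) := FreeGroup.lift fun z =>
    .ofAdd (if z = x then 1 else 0, if z = y then 1 else 0)
  have hfx : f (.of x) = .ofAdd (1, 0) := by simp [f, hxy]
  have hfy : f (.of y) = .ofAdd (0, 1) := by simp [f, hxy.symm]
  have hfδ : f δ = 1 := by
    refine (Subgroup.closure_le f.ker).2 ?_ hδ
    rintro _ ⟨z, hz, rfl⟩
    simp_all [f]
  have hfγ : f (.of x * .of y * (.of x)⁻¹ * (.of y)⁻¹ * δ) = 1 := by
    simp only [map_mul, map_inv, hfδ, mul_one]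
    rw [mul_inv_cancel_comm, mul_inv_cancel]
  have hf {v} (hv : f v ≠ 1) := notMem_zpowers_of_map_ne_one f hfγ hv
  have hδ0 {D : FreeGroup X → ℤ[FreeGroup X]} (hD : IsFoxDerivation (.id _) D)
      (hz : ∀ z, z ≠ x → z ≠ y → D (.of z) = 0) : D δ = 0 :=
    hD.map_eq_zero_of_mem_closure (by simpa using hz) hδ
  refine ⟨.of x * .of y * (.of x)⁻¹, .of x * .of y * (.of x)⁻¹ * (.of y)⁻¹ * (.of x)⁻¹,
    hf ?_, hf ?_, hf ?_, ?_⟩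
  · simp [hfx, hfy, ← ofAdd_neg, ← ofAdd_add]
  · simp [hfx, hfy, ← ofAdd_neg, ← ofAdd_add]
  · simp [hfx, hfy, ← ofAdd_neg, ← ofAdd_add]
  rintro u (rfl | rfl)
  · obtain ⟨D, hD, hDz⟩ := exists_isFoxDerivation_of_eq (.id _) (Pi.single x 1)
    refine ⟨D, hD, ?_⟩
    have := hδ0 hD fun z hzx _ => by simp [hDz, hzx]
    simp [hD _ _, hD.map_inv, hDz, hxy.symm, this, MonoidAlgebra.single_mul_single, sub_eq_add_neg]
  · obtain ⟨D, hD, hDz⟩ := exists_isFoxDerivation_of_eq (.id _) (Pi.single y (of ℤ _ (.of x)⁻¹))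
    refine ⟨D, hD, ?_⟩
    have := hδ0 hD fun z _ hzy => by simp [hDz, hzy]
    simp [hD _ _, hD.map_inv, hDz, hxy, this, MonoidAlgebra.single_mul_single,
      MonoidAlgebra.one_def, sub_eq_add_neg, mul_add, mul_assoc]

theorem isBoundaryElement_commutatorProduct {n : ℕ} (hn : 1 ≤ n) :
    IsBoundaryElement (commutatorProduct n) := by
  obtain ⟨n, rfl⟩ := Nat.exists_eq_add_of_le' hn
  rw [commutatorProduct, List.ofFn_succ, List.prod_cons]
  refine isBoundaryElement_commutator_mul (by simp) (Subgroup.list_prod_mem _ fun z hz => ?_)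
  obtain ⟨i, rfl⟩ := List.mem_ofFn.1 hz
  have hof {z : Fin (n + 1) ⊕ Fin (n + 1)} (hz : z ∈ ({.inl 0, .inr 0}ᶜ : Set _)) :=
    Subgroup.subset_closure (Set.mem_image_of_mem FreeGroup.of hz)
  have hx := hof (z := .inl i.succ) (by simp)
  have hy := hof (z := .inr i.succ) (by simp)
  exact mul_mem (mul_mem (mul_mem hx hy) (inv_mem hx)) (inv_mem hy)

end Commutator

end FreeGroup

/-! ### Conjugacy in quotient amalgams -/

section Exponents

open Filter Subgroup

theorem exists_forall_dvd_sub_imp_eq {p : ℕ} (hp : 1 < p) {A : Set ℤ} (hA : A.Finite) :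
    ∃ K : ℕ, ∀ a ∈ A, ∀ b ∈ A, (p : ℤ) ^ K ∣ a - b → a = b := by
  obtain ⟨B, hB⟩ := (hA.image2 (fun a b => |a - b|) hA).bddAbove
  obtain ⟨K, hK⟩ := pow_unbounded_of_one_lt B (Nat.one_lt_cast.2 hp)
  refine ⟨K, fun a ha b hb hdvd => sub_eq_zero.1 (Int.eq_zero_of_abs_lt_dvd hdvd ?_)⟩
  exact (hB (Set.mem_image2_of_mem ha hb)).trans_lt hK

variable {p : ℕ} [hp : Fact p.Prime]

theorem IsBoundaryElement.exists_finite_forall_eventually {F : Type*} [Group F] {γ : F}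
    (hγ : IsBoundaryElement γ) (hF : IsResiduallyP p F) {X Y : Set F} (hX : X.Finite)
    (hY : Y.Finite) (hXγ : ∀ x ∈ X, x ∉ zpowers γ) :
    ∃ A : Set ℤ, A.Finite ∧ ∀ K : ℕ, ∀ᶠ N : PNormal p F in atBot, ∀ x ∈ X, ∀ y ∈ Y, ∀ a b : ℤ,
      ((γ ^ a * x : F) : F ⧸ N.1) = (y * γ ^ b : F) →
        ∃ a₀ ∈ A, ∃ b₀ ∈ A, γ ^ a₀ * x = y * γ ^ b₀ ∧
          (p : ℤ) ^ K ∣ a - a₀ ∧ (p : ℤ) ^ K ∣ b - b₀ := by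
  choose! a₀ b₀ h using fun x (hx : x ∈ X) => hγ.exists_forall_eventually_dvd hF (hXγ x hx)
  refine ⟨Set.image2 a₀ X Y ∪ Set.image2 b₀ X Y, (hX.image2 _ hY).union (hX.image2 _ hY),
    fun K => ?_⟩
  have hXY : ∀ᶠ N : PNormal p F in atBot, ∀ x ∈ X, ∀ y ∈ Y, _ :=
    (eventually_all_finite hX).2 fun x hx => (eventually_all_finite hY).2 fun y _ => h x hx y K
  filter_upwards [hXY] with N hN x hx y hy a b hab
  exact ⟨_, .inl (Set.mem_image2_of_mem hx hy), _, .inr (Set.mem_image2_of_mem hx hy),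
    hN x hx y hy a b hab⟩

theorem exists_pNormal_family {ι : Type*} [Finite ι] {G : ι → Type*} [∀ i, Group (G i)]
    {γ : ∀ i, G i} (hG : ∀ i, IsResiduallyP p (G i)) (hγ : ∀ i, IsBoundaryElement (γ i))
    {S : ∀ i, PNormal p (G i) → Prop} (hS : ∀ i, ∀ᶠ N in atBot, S i N) (K : ℕ) :
    ∃ (N : ∀ i, PNormal p (G i)) (R : ℕ), K ≤ R ∧ (∀ i, S i (N i)) ∧
      ∀ i (a : ℤ), γ i ^ a ∈ (N i).1 ↔ (p : ℤ) ^ R ∣ a := by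
  choose N₀ hN₀ using fun i => eventually_atBot.1 (hS i)
  obtain ⟨R, hKR, hR⟩ := ((eventually_ge_atTop K).and <| eventually_all.2 fun i =>
    (hγ i).eventually_exists_zpow_mem_iff_dvd (hG i) (N₀ i)).exists
  choose N hN hmem using hR
  exact ⟨N, R, hKR, fun i => hN₀ i _ (hN i), hmem⟩

end Exponents

namespace Amalgam

open Monoid

section Map

variable {ι : Type*} {G P : ι → Type*} [∀ i, Group (G i)] [∀ i, Group (P i)] {C D : Type*}
  [Group C] [Group D] {φ : ∀ i, C →* G i} {κ : ∀ i, D →* P i}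

/-- The homomorphism of amalgams induced by compatible homomorphisms of the factors and of the
amalgamated subgroups. -/
def map (θ : ∀ i, G i →* P i) (ψ : C →* D) (h : ∀ i, (θ i).comp (φ i) = (κ i).comp ψ) :
    PushoutI φ →* PushoutI κ :=
  PushoutI.lift (fun i => (PushoutI.of i).comp (θ i)) ((PushoutI.base κ).comp ψ) fun i => by
    rw [MonoidHom.comp_assoc, h, ← MonoidHom.comp_assoc, PushoutI.of_comp_eq_base]

/-- The image of a word under homomorphisms of the factors. -/
def mapList (θ : ∀ i, G i →* P i) (L : List (Σ i, G i)) : List (Σ i, P i) :=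
  L.map fun x => ⟨x.1, θ x.1 x.2⟩

variable {θ : ∀ i, G i →* P i}

@[simp] theorem mapList_cons (x : Σ i, G i) (L : List (Σ i, G i)) :
    mapList θ (x :: L) = ⟨x.1, θ x.1 x.2⟩ :: mapList θ L := rfl

@[simp] theorem map_fst_mapList (L : List (Σ i, G i)) :
    (mapList θ L).map Sigma.fst = L.map Sigma.fst := by
  simp [mapList, Function.comp_def]

@[simp] theorem length_mapList {L : List (Σ i, G i)} : (mapList θ L).length = L.length :=
  List.length_map _

@[simp] theorem mapList_eq_nil {L : List (Σ i, G i)} : mapList θ L = [] ↔ L = [] :=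
  List.map_eq_nil_iff

theorem mapList_isRotated {L : List (Σ i, G i)} {M : List (Σ i, P i)} (h : mapList θ L ~r M) :
    ∃ L', L ~r L' ∧ M = mapList θ L' := by
  obtain ⟨n, rfl⟩ := h
  exact ⟨L.rotate n, ⟨n, rfl⟩, (List.map_rotate _ _ _).symm⟩

variable {ψ : C →* D} (h : ∀ i, (θ i).comp (φ i) = (κ i).comp ψ)

@[simp] theorem map_of (i : ι) (x : G i) :
    map θ ψ h (PushoutI.of i x) = PushoutI.of i (θ i x) := by
  simp [map]

theorem map_listProd (L : List (Σ i, G i)) :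
    map θ ψ h (listProd φ L) = listProd κ (mapList θ L) := by
  induction L with
  | nil => simp [mapList]
  | cons x L ih => simp [ih]

theorem IsCyclicList.mapList {L : List (Σ i, G i)} (hL : IsCyclicList φ L)
    (h : ∀ x ∈ L, θ x.1 x.2 ∉ (κ x.1).range) : IsCyclicList κ (mapList θ L) := by
  refine ⟨⟨by simpa only [map_fst_mapList] using hL.1.1, ?_⟩,
    by simpa only [map_fst_mapList] using hL.2⟩
  intro x hx
  obtain ⟨y, hy, rfl⟩ := List.mem_map.1 hx
  exact h y hy

end Map

section Lift

variable {ι : Type*} {G P : ι → Type*} [∀ i, Group (G i)] [∀ i, Group (P i)] {C D : Type*}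
  [Group C] [Group D] {φ : ∀ i, C →* G i} {κ : ∀ i, D →* P i} {θ : ∀ i, G i →* P i}

/-- `LiftsSolutions φ κ θ r L M` says that every solution `(c, d)` of a letter equation
`c x = y d` in the target of `θ`, with `x` a letter of `L` and `y` a letter of `M`, comes from a
solution `(a, b)` in the source that is related to it by `r`. -/
def LiftsSolutions (φ : ∀ i, C →* G i) (κ : ∀ i, D →* P i) (θ : ∀ i, G i →* P i)
    (r : C → D → Prop) (L M : List (Σ i, G i)) : Prop :=
  ∀ i x y, ⟨i, x⟩ ∈ L → ⟨i, y⟩ ∈ M → ∀ c d, κ i c * θ i x = θ i y * κ i d →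
    ∃ a b, r a c ∧ r b d ∧ φ i a * x = y * φ i b

variable {r : C → D → Prop} {L M : List (Σ i, G i)}

theorem LiftsSolutions.exists_linked (hr : Relator.LeftUnique r)
    (hlift : LiftsSolutions φ κ θ r L M) {a : C} {c d : D} (hac : r a c)
    (h : Linked κ c (mapList θ L) (mapList θ M) d) : ∃ b, r b d ∧ Linked φ a L M b := by
  induction L generalizing M a c with
  | nil =>
    rcases M with _ | ⟨y, M⟩
    · cases h
      exact ⟨a, hac, .nil a⟩
    · cases h
  | cons x L ih =>
    obtain ⟨i, x⟩ := x
    rcases M with _ | ⟨⟨j, y⟩, M⟩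
    · cases h
    rw [mapList_cons, mapList_cons] at h
    obtain _ | ⟨hxy, h⟩ := h
    obtain ⟨a', b, ha', hb, hab⟩ := hlift i x y List.mem_cons_self List.mem_cons_self _ _ hxy
    obtain rfl := hr hac ha'
    obtain ⟨b', hb', hlink⟩ := ih (fun i x y hx hy => hlift i x y (List.mem_cons_of_mem _ hx)
      (List.mem_cons_of_mem _ hy)) hb h
    exact ⟨b', hb', .cons hab hlink⟩

theorem LiftsSolutions.isConj_of_linked (hr : Relator.LeftUnique r)
    (hlift : LiftsSolutions φ κ θ r L M) {c : D}
    (h : Linked κ c (mapList θ L) (mapList θ M) c) :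
    IsConj (listProd φ L) (listProd φ M) := by
  rcases L with _ | ⟨⟨i, x⟩, L⟩ <;> rcases M with _ | ⟨⟨j, y⟩, M⟩
  · rfl
  · cases h
  · cases h
  obtain ⟨a, hac⟩ : ∃ a, r a c := by
    rw [mapList_cons, mapList_cons] at h
    obtain _ | ⟨hxy, -⟩ := h
    obtain ⟨a, b, ha, -⟩ := hlift i x y List.mem_cons_self List.mem_cons_self _ _ hxy
    exact ⟨a, ha⟩
  obtain ⟨b, hbc, hlink⟩ := hlift.exists_linked hr hac h
  obtain rfl := hr hac hbc
  exact isConj_iff.2 ⟨PushoutI.base φ a, by rw [hlink.base_mul_eq, mul_inv_cancel_right]⟩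

theorem LiftsSolutions.isConj_of_isConj_mapList (hr : Relator.LeftUnique r)
    (hκ : ∀ i, Function.Injective (κ i)) (hlift : LiftsSolutions φ κ θ r L M)
    (hL : IsCyclicList κ (mapList θ L)) (hM : IsCyclicList κ (mapList θ M))
    (h : IsConj (listProd κ (mapList θ L)) (listProd κ (mapList θ M))) :
    IsConj (listProd φ L) (listProd φ M) := by
  obtain ⟨_, c, hrot, hlink⟩ := hL.exists_linked_of_isConj hκ hM h
  obtain ⟨L', hL', rfl⟩ := mapList_isRotated hrot
  have hlift' : LiftsSolutions φ κ θ r L' M := fun i x y hx =>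
    hlift i x y (hL'.mem_iff.2 hx)
  exact (isConj_listProd_of_isRotated hL').trans (hlift'.isConj_of_linked hr hlink)

end Lift

section Fin

theorem getLast?_cons_eq_iff_even (i : Fin 2) (l : List (Fin 2)) (h : (i :: l).IsChain (· ≠ ·)) :
    (i :: l).getLast? = some i ↔ Even l.length := by
  induction l generalizing i with
  | nil => simp
  | cons j l ih =>
    rw [List.isChain_cons_cons] at h
    rw [List.getLast?_cons_cons, List.length_cons, Nat.even_add_one, ← ih j h.2,
      List.getLast?_eq_getLast_of_ne_nil (by simp), Option.some_inj, Option.some_inj]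
    have := h.1
    generalize (j :: l).getLast _ = k
    lia

theorem IsReduced.isCyclicList_of_even {H : Fin 2 → Type*} [∀ i, Group (H i)] {C : Type*} [Group C]
    {φ : ∀ i, C →* H i} {L : List (Σ i, H i)} (hL : IsReduced φ L) (hne : L ≠ [])
    (heven : Even L.length) : IsCyclicList φ L := by
  rcases L with _ | ⟨x, L⟩
  · exact absurd rfl hne
  refine ⟨hL, fun hlast => ?_⟩
  have heven' := (getLast?_cons_eq_iff_even _ _ hL.isChain).1 (hlast.symm.trans rfl)
  rw [List.length_map] at heven'
  rw [List.length_cons, Nat.even_add_one] at heven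
  exact heven heven'

end Fin

section Quotient

variable {ι : Type*} {G : ι → Type*} [∀ i, Group (G i)] {C : Type*} [Group C] {φ : ∀ i, C →* G i}
  {N : ∀ i, Subgroup (G i)} [∀ i, (N i).Normal] {S : Subgroup C} [S.Normal]

/-- The inclusions of the quotient amalgam: if all the normal subgroups `N i` meet the amalgamated
subgroup `C` in the same subgroup `S`, then `C ⧸ S` embeds into all the quotients `G i ⧸ N i`. -/
def quotientMap (hS : ∀ i, (N i).comap (φ i) = S) (i : ι) : C ⧸ S →* G i ⧸ N i :=
  QuotientGroup.map S (N i) (φ i) (hS i).ge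

theorem quotientMap_comp_mk' (hS : ∀ i, (N i).comap (φ i) = S) (i : ι) :
    (quotientMap hS i).comp (QuotientGroup.mk' S) = (QuotientGroup.mk' (N i)).comp (φ i) :=
  rfl

theorem quotientMap_injective (hS : ∀ i, (N i).comap (φ i) = S) (i : ι) :
    Function.Injective (quotientMap hS i) := by
  obtain rfl := hS i
  rw [← MonoidHom.ker_eq_bot_iff, quotientMap, QuotientGroup.ker_map]
  exact QuotientGroup.map_mk'_self _

theorem mk_notMem_range_quotientMap (hS : ∀ i, (N i).comap (φ i) = S) {i : ι} {x : G i}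
    (hx : ∀ c, φ i c * x ∉ N i) : (x : G i ⧸ N i) ∉ (quotientMap hS i).range := by
  rintro ⟨c, hc⟩
  obtain ⟨c, rfl⟩ := QuotientGroup.mk_surjective c
  refine hx c⁻¹ ?_
  rw [map_inv]
  exact QuotientGroup.eq.1 hc

/-- The homomorphism from an amalgam to its quotient amalgam. -/
def quotientAmalgam (hS : ∀ i, (N i).comap (φ i) = S) : PushoutI φ →* PushoutI (quotientMap hS) :=
  map (fun i => QuotientGroup.mk' (N i)) (QuotientGroup.mk' S) fun i =>
    (quotientMap_comp_mk' hS i).symm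

theorem quotientAmalgam_of (hS : ∀ i, (N i).comap (φ i) = S) (i : ι) (x : G i) :
    quotientAmalgam hS (PushoutI.of i x) = PushoutI.of i (x : G i ⧸ N i) :=
  map_of _ i x

theorem quotientAmalgam_listProd (hS : ∀ i, (N i).comap (φ i) = S) (L : List (Σ i, G i)) :
    quotientAmalgam hS (listProd φ L) =
      listProd (quotientMap hS) (mapList (fun i => QuotientGroup.mk' (N i)) L) :=
  map_listProd _ L

end Quotient

section Cyclic

open Filter

/-- `IsApproximation p A K a c`: the exponent `a` belongs to `A` and is congruent modulo `p ^ K` to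
a representative of the class `c`. This is how the exponents that solve a letter equation in the
amalgam are recovered from a solution in a quotient amalgam. -/
def IsApproximation (p : ℕ) (A : Set ℤ) (K : ℕ) {S : Subgroup (Multiplicative ℤ)}
    (a : Multiplicative ℤ) (c : Multiplicative ℤ ⧸ S) : Prop :=
  a.toAdd ∈ A ∧ ∃ a' : Multiplicative ℤ, a' = c ∧ (p : ℤ) ^ K ∣ a'.toAdd - a.toAdd

theorem isApproximation_leftUnique {p K : ℕ} {A : Set ℤ}
    (hA : ∀ a ∈ A, ∀ b ∈ A, (p : ℤ) ^ K ∣ a - b → a = b) {S : Subgroup (Multiplicative ℤ)}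
    (hS : ∀ a ∈ S, (p : ℤ) ^ K ∣ a.toAdd) :
    Relator.LeftUnique (IsApproximation (S := S) p A K) := by
  rintro a b c ⟨ha, a', hac, ha'⟩ ⟨hb, b', hbc, hb'⟩
  have hab' : (p : ℤ) ^ K ∣ b'.toAdd - a'.toAdd := by
    simpa [neg_add_eq_sub] using hS _ (QuotientGroup.eq.1 (hac.trans hbc.symm))
  refine Multiplicative.toAdd.injective (hA _ ha _ hb ?_)
  have hab := hb'.sub (hab'.add ha')
  rwa [sub_add_sub_cancel, sub_sub_sub_cancel_left] at hab

theorem finite_letters {ι : Type*} {G : ι → Type*} (L : List (Σ i, G i)) (i : ι) :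
    {x | (⟨i, x⟩ : Σ i, G i) ∈ L}.Finite :=
  L.finite_toSet.preimage sigma_mk_injective.injOn

variable {ι : Type*} {G : ι → Type*} [∀ i, Group (G i)] {γ : ∀ i, G i}

theorem IsReduced.notMem_zpowers {L : List (Σ i, G i)}
    (hL : IsReduced (fun i => zpowersHom (G i) (γ i)) L) {i : ι} {x : G i} (hx : ⟨i, x⟩ ∈ L) :
    x ∉ Subgroup.zpowers (γ i) :=
  fun ⟨a, ha⟩ => hL.notMem_range _ hx ⟨.ofAdd a, ha⟩

variable {p : ℕ} [hp : Fact p.Prime]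

theorem IsReduced.eventually_forall_zpow_mul_notMem {L : List (Σ i, G i)}
    (hL : IsReduced (fun i => zpowersHom (G i) (γ i)) L) {i : ι} (hG : IsResiduallyP p (G i))
    (hγ : IsBoundaryElement (γ i)) :
    ∀ᶠ N : PNormal p (G i) in atBot, ∀ x, ⟨i, x⟩ ∈ L → ∀ a : ℤ, γ i ^ a * x ∉ N.1 :=
  (eventually_all_finite (finite_letters L i)).2 fun _ hx =>
    hγ.eventually_forall_zpow_mul_notMem hG (hL.notMem_zpowers hx)

variable [Finite ι]

theorem exists_liftsSolutions (hG : ∀ i, IsResiduallyP p (G i))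
    (hγ : ∀ i, IsBoundaryElement (γ i)) {L M : List (Σ i, G i)}
    (hL : IsCyclicList (fun i => zpowersHom (G i) (γ i)) L)
    (hM : IsCyclicList (fun i => zpowersHom (G i) (γ i)) M) :
    ∃ (N : ∀ i, PNormal p (G i)) (S : Subgroup (Multiplicative ℤ))
      (hS : ∀ i, (N i).1.comap (zpowersHom (G i) (γ i)) = S)
      (r : Multiplicative ℤ → Multiplicative ℤ ⧸ S → Prop),
      Relator.LeftUnique r ∧
      LiftsSolutions (fun i => zpowersHom (G i) (γ i)) (quotientMap hS)
        (fun i => QuotientGroup.mk' (N i).1) r L M ∧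
      IsCyclicList (quotientMap hS) (mapList (fun i => QuotientGroup.mk' (N i).1) L) ∧
      IsCyclicList (quotientMap hS) (mapList (fun i => QuotientGroup.mk' (N i).1) M) := by
  choose A hA hsol using fun i =>
    (hγ i).exists_finite_forall_eventually (hG i) (finite_letters L i) (finite_letters M i)
      fun x hx => hL.isReduced.notMem_zpowers hx
  obtain ⟨K, hK⟩ := exists_forall_dvd_sub_imp_eq hp.out.one_lt (Set.finite_iUnion hA)
  obtain ⟨N, R, hKR, hN, hR⟩ := exists_pNormal_family hG hγ
    (fun i => (hsol i K).and
      ((hL.isReduced.eventually_forall_zpow_mul_notMem (hG i) (hγ i)).and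
        (hM.isReduced.eventually_forall_zpow_mul_notMem (hG i) (hγ i)))) K
  have hS (i : ι) : (N i).1.comap (zpowersHom (G i) (γ i)) =
      (AddSubgroup.zmultiples ((p : ℤ) ^ R)).toSubgroup := by
    ext a
    exact (hR i _).trans Int.mem_zmultiples_iff.symm
  refine ⟨N, _, hS, IsApproximation p (⋃ i, A i) K, isApproximation_leftUnique hK
    fun a ha => (pow_dvd_pow _ hKR).trans (Int.mem_zmultiples_iff.1 ha), ?_,
    hL.mapList fun x hx => mk_notMem_range_quotientMap hS fun c => (hN x.1).2.1 x.2 hx _,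
    hM.mapList fun x hx => mk_notMem_range_quotientMap hS fun c => (hN x.1).2.2 x.2 hx _⟩
  intro i x y hx hy c d hcd
  obtain ⟨c, rfl⟩ := QuotientGroup.mk_surjective c
  obtain ⟨d, rfl⟩ := QuotientGroup.mk_surjective d
  obtain ⟨a, ha, b, hb, hab, hca, hdb⟩ := (hN i).1 x hx y hy c.toAdd d.toAdd hcd
  exact ⟨.ofAdd a, .ofAdd b, ⟨Set.mem_iUnion_of_mem i ha, c, rfl, hca⟩,
    ⟨Set.mem_iUnion_of_mem i hb, d, rfl, hdb⟩, hab⟩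

theorem IsCyclicList.exists_not_isConj [Nonempty ι] (hG : ∀ i, IsResiduallyP p (G i))
    (hγ : ∀ i, IsBoundaryElement (γ i)) {L : List (Σ i, G i)}
    (hL : IsCyclicList (fun i => zpowersHom (G i) (γ i)) L)
    {h : PushoutI fun i => zpowersHom (G i) (γ i)} (hh : ¬ IsConj h (listProd _ L)) :
    ∃ (N : ∀ i, PNormal p (G i)) (S : Subgroup (Multiplicative ℤ))
      (hS : ∀ i, (N i).1.comap (zpowersHom (G i) (γ i)) = S),
      IsCyclicList (quotientMap hS) (Amalgam.mapList (fun i => QuotientGroup.mk' (N i).1) L) ∧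
      ¬ IsConj (quotientAmalgam hS h) (quotientAmalgam hS (listProd _ L)) := by
  obtain ⟨i, x, hx⟩ | ⟨M, hM, hMh⟩ := exists_isConj_of_or_isCyclicList
    (fun i => (hγ i).zpowersHom_injective (hG i)) h
  · obtain ⟨N, S, hS, -, -, -, hLN, -⟩ := exists_liftsSolutions hG hγ hL hL
    refine ⟨N, S, hS, hLN, fun hconj => ?_⟩
    have hconj' := ((quotientAmalgam hS).map_isConj hx).trans hconj
    rw [quotientAmalgam_of, quotientAmalgam_listProd] at hconj'
    exact hLN.not_isConj_of (quotientMap_injective hS) _ _ hconj'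
  · obtain ⟨N, S, hS, r, hr, hlift, hMN, hLN⟩ := exists_liftsSolutions hG hγ hM hL
    refine ⟨N, S, hS, hLN, fun hconj => hh (hMh.symm.trans ?_)⟩
    have hconj' := ((quotientAmalgam hS).map_isConj hMh).trans hconj
    rw [quotientAmalgam_listProd, quotientAmalgam_listProd] at hconj'
    exact hlift.isConj_of_isConj_mapList hr (quotientMap_injective hS) hMN hLN hconj'

end Cyclic

section NormalForm

variable {H : Fin 2 → Type*} [∀ i, Group (H i)] {C : Type*} [Group C] {φ : ∀ i, C →* H i}

theorem exists_isNormalForm_of_syllableLength_pos {g : PushoutI φ} (hg : 0 < syllableLength g) :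
    ∃ w, IsNormalForm g w ∧ w.toList.length = syllableLength g :=
  Nat.sInf_mem (Nat.nonempty_of_pos_sInf hg)

theorem IsNormalForm.listProd_toList {g : PushoutI φ} {w : CoprodI.Word H}
    (hw : IsNormalForm g w) : listProd φ w.toList = g := by
  rw [← ofCoprodI_prod_eq_listProd, hw.2.2]

theorem IsNormalForm.isCyclicList {g : PushoutI φ} {w : CoprodI.Word H} (hw : IsNormalForm g w)
    (heven : Even w.toList.length) : IsCyclicList φ w.toList :=
  IsReduced.isCyclicList_of_even ⟨(List.isChain_map _).2 w.chain_ne, hw.2.1⟩ hw.1 heven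

theorem IsReduced.isNormalForm {L : List (Σ i, H i)} (hL : IsReduced φ L) (hne : L ≠ []) :
    IsNormalForm (listProd φ L) hL.word :=
  ⟨hne, hL.notMem_range, ofCoprodI_prod_eq_listProd _⟩

theorem IsReduced.isCyclicallyReduced_listProd {L : List (Σ i, H i)} (hL : IsReduced φ L)
    (hne : L ≠ []) (heven : Even L.length) : IsCyclicallyReduced (listProd φ L) :=
  .inr ⟨_, hL.isNormalForm hne, .inr heven⟩

theorem IsReduced.syllableLength_listProd (hφ : ∀ i, Function.Injective (φ i))
    {L : List (Σ i, H i)} (hL : IsReduced φ L) (hne : L ≠ []) :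
    syllableLength (listProd φ L) = L.length :=
  ((hL.isNormalForm hne).length_eq hφ).symm

end NormalForm

end Amalgam

universe u

theorem proposition4p5_general {p : ℕ} [Fact p.Prime] {G : Fin 2 → Type u} [∀ i, Group (G i)]
    {γ : ∀ i, G i} (hG : ∀ i, IsResiduallyP p (G i)) (hγ : ∀ i, IsBoundaryElement (γ i))
    {g h : Monoid.PushoutI fun i => zpowersHom (G i) (γ i)} {l : ℕ} (hl : 0 < l)
    (hgl : Amalgam.syllableLength g = 2 * l) (hgh : ¬ IsConj h g) :
    ∃ (P : Fin 2 → Type u) (_ : ∀ i, Group (P i)) (C : Type) (_ : Group C) (κ : ∀ i, C →* P i)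
      (φ : (Monoid.PushoutI fun i => zpowersHom (G i) (γ i)) →* Monoid.PushoutI κ),
      (∀ i, Finite (P i)) ∧ (∀ i, IsPGroup p (P i)) ∧
      IsCyclic C ∧ (∀ i, Function.Injective (κ i)) ∧
      Amalgam.IsCyclicallyReduced (φ g) ∧
      Amalgam.syllableLength (φ g) = 2 * l ∧
      ¬ IsConj (φ h) (φ g) := by
  obtain ⟨w, hw, hlen⟩ := Amalgam.exists_isNormalForm_of_syllableLength_pos (g := g) (by lia)
  have heven : Even w.toList.length := by simp [hlen, hgl]
  rw [← hw.listProd_toList] at hgh ⊢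
  obtain ⟨N, S, hS, hL, hconj⟩ := (hw.isCyclicList heven).exists_not_isConj hG hγ hgh
  have hκ := Amalgam.quotientMap_injective hS
  have hne := (Amalgam.mapList_eq_nil (θ := fun i => QuotientGroup.mk' (N i).1)).not.2 hw.1
  refine ⟨_, inferInstance, _, inferInstance, Amalgam.quotientMap hS, Amalgam.quotientAmalgam hS,
    fun _ => inferInstance, fun i => isPGroup_quotient (N i),
    isCyclic_of_surjective _ (QuotientGroup.mk'_surjective S), hκ, ?_, ?_, hconj⟩
  · rw [Amalgam.quotientAmalgam_listProd]
    exact hL.isReduced.isCyclicallyReduced_listProd hne (by rwa [Amalgam.length_mapList])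
  · rw [Amalgam.quotientAmalgam_listProd, hL.isReduced.syllableLength_listProd hκ hne,
      Amalgam.length_mapList, hlen, hgl]

theorem proposition4p5 (p : ℕ) (hp : p.Prime) (ρ : ℕ) (hρ : 2 ≤ ρ) (x : ClosedSurface ρ)
    (n : Fin 2 → ℕ) (hn : ∀ i, 1 ≤ n i)
    (e : FundamentalGroup (ClosedSurface ρ) x ≃* SurfaceAmalgam n)
    (g h : FundamentalGroup (ClosedSurface ρ) x) (l : ℕ) (hl : 2 ≤ 2 * l)
    (hg : Amalgam.IsCyclicallyReduced (e g)) (hgl : Amalgam.syllableLength (e g) = 2 * l)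
    (hgh : ¬ IsConj h g) :
    ∃ (P : Fin 2 → Type) (_ : ∀ i, Group (P i)) (C : Type) (_ : Group C) (κ : ∀ i, C →* P i)
      (φ : SurfaceAmalgam n →* Monoid.PushoutI κ),
      (∀ i, Finite (P i)) ∧ (∀ i, IsPGroup p (P i)) ∧
      IsCyclic C ∧ (∀ i, Function.Injective (κ i)) ∧
      Amalgam.IsCyclicallyReduced (φ (e g)) ∧
      Amalgam.syllableLength (φ (e g)) = 2 * l ∧
      ¬ IsConj (φ (e h)) (φ (e g)) :=
  have := Fact.mk hp
  proposition4p5_general (fun _ => freeGroup_isResiduallyP)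
    (fun i => isBoundaryElement_commutatorProduct (hn i)) (by lia) hgl
    fun hc => hgh (by simpa using e.symm.toMonoidHom.map_isConj hc)
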